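/- Let $d\ge 3$ be an integer, $\gamma\in(0,2)$, $2^*_\gamma:=2\,\frac{d-\gamma}{d-2}$ and $1<p<2^*_\gamma/2$. For $q\geq 1$ put $\|w\|_{q,\gamma}:=\big(\int_{\mathbb R^d}|w|^q\,|x|^{-\gamma}\,dx\big)^{1/q}$ and $\|w\|_q:=\|w\|_{q,0}$. Let $L^q_\gamma(\mathbb R^d)$ be the space of (a.e. classes of) measurable functions $w:\mathbb R^d\to\mathbb R$ with $\|w\|_{q,\gamma}<\infty$, and let $\mathcal H_{p,\gamma}(\mathbb R^d)$ be the space of those $w\in L^{p+1}_\gamma(\mathbb R^d)$ whose distributional gradient $\nabla w$ belongs to $L^2(\mathbb R^d)$, with norm $\|w\|_{p+1,\gamma}+\|\nabla w\|_2$. For $w\in\mathcal H_{p,\gamma}(\mathbb R^d)$ let $$\mathcal G_\gamma[w]:=\tfrac12\,\|\nabla w\|_2^2+\tfrac1{p+1}\,\|w\|_{p+1,\gamma}^{p+1},\qquad \theta_\gamma:=\frac{d+2-2\gamma-p\,(d-2)}{d-\gamma-p\,(d+\gamma-4)},$$ and let $\mathsf J_\gamma$ be the largest constant such that $\mathcal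 G_\gamma[w]-\mathsf J_\gamma\,\|w\|_{2p,\gamma}^{2p\,\theta_\gamma}\ge0$ for all $w\in\mathcal H_{p,\gamma}(\mathbb R^d)$. Then: 1. $\mathcal H_{p,\gamma}(\mathbb R^d)$ is compactly embedded in $L^{2p}_\gamma(\mathbb R^d)$: every $w\in\mathcal H_{p,\gamma}(\mathbb R^d)$ belongs to $L^{2p}_\gamma(\mathbb R^d)$, and the inclusion is an injective, continuous and compact linear map. 2. For every $M>0$, $$\mathsf J_\gamma=\frac1{M^{\theta_\gamma}}\,\inf\big\{\mathcal G_\gamma[w]\,:\,w\in\mathcal H_{p,\gamma}(\mathbb R^d),\ \|w\|_{2p,\gamma}^{2p}=M\big\},$$ and the infimum is attained: there is $w_\gamma\in\mathcal H_{p,\gamma}(\mathbb R^d)$ with $\|w_\gamma\|_{2p,\gamma}^{2p}=M$ and $\mathcal G_\gamma[w_\gamma]=\mathsf J_\gamma\,M^{\theta_\gamma}$, so that $w_\gamma$ minimizes $\mathcal G_\gamma$ among all functions in $\mathcal H_{p,\gamma}(\mathbb R^d)$ with mass $M$. -/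

import Mathlib

open MeasureTheory
open scoped ENNReal ContDiff

noncomputable section

namespace CKN

/-- The Euclidean space `ℝ^d`. -/
abbrev Space (d : ℕ) : Type := EuclideanSpace ℝ (Fin d)

/-- The measure `|x|^{-γ} dx` on `ℝ^d`. -/
def weightedMeasure (d : ℕ) (γ : ℝ) : Measure (Space d) :=
  volume.withDensity fun x => ENNReal.ofReal (‖x‖ ^ (-γ))

/-- The weighted norm `‖f‖_{q,γ} = (∫ |f|^q |x|^{-γ} dx)^{1/q}`. -/
def wnorm {d : ℕ} {F : Type*} [NormedAddCommGroup F] (q γ : ℝ) (f : Space d → F) : ℝ :=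
  (∫ x, ‖f x‖ ^ q * ‖x‖ ^ (-γ)) ^ (1 / q)

/-- The critical exponent `2^*_γ = 2 (d - γ) / (d - 2)`. -/
def critExp (d : ℕ) (γ : ℝ) : ℝ := 2 * ((d - γ) / (d - 2))

/-- The space `L^q_γ(ℝ^d)` of (classes of) real functions with `‖f‖_{q,γ} < ∞`. -/
abbrev WLp (d : ℕ) (γ q : ℝ) : Type := Lp ℝ (ENNReal.ofReal q) (weightedMeasure d γ)

/-- `g` is the gradient of `w` on `ℝ^d` in the sense of distributions. -/
structure HasWeakGradient {d : ℕ} (w : Space d → ℝ) (g : Space d → Space d) : Prop where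
  locInt : LocallyIntegrable w volume
  locInt_grad : LocallyIntegrable g volume
  integral_eq : ∀ φ : Space d → ℝ, ContDiff ℝ ∞ φ → HasCompactSupport φ → ∀ v : Space d,
    ∫ x, w x * fderiv ℝ φ x v = -∫ x, inner ℝ (g x) v * φ x

theorem HasWeakGradient.congr {d : ℕ} {w w' : Space d → ℝ} {g g' : Space d → Space d}
    (h : HasWeakGradient w g) (hw : w' =ᵐ[volume] w) (hg : g' =ᵐ[volume] g) :
    HasWeakGradient w' g' where
  locInt := h.locInt.congr hw.symm
  locInt_grad := h.locInt_grad.congr hg.symm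
  integral_eq φ h1 h2 v := by
    have e1 : ∫ x, w' x * fderiv ℝ φ x v = ∫ x, w x * fderiv ℝ φ x v :=
      integral_congr_ae (by filter_upwards [hw] with x hx; rw [hx])
    have e2 : ∫ x, inner ℝ (g' x) v * φ x = ∫ x, inner ℝ (g x) v * φ x :=
      integral_congr_ae (by filter_upwards [hg] with x hx; rw [hx])
    rw [e1, e2, h.integral_eq φ h1 h2 v]

theorem HasWeakGradient.integrable_left {d : ℕ} {w : Space d → ℝ} {g : Space d → Space d}
    (h : HasWeakGradient w g) {φ : Space d → ℝ} (h1 : ContDiff ℝ ∞ φ) (h2 : HasCompactSupport φ)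
    (v : Space d) : Integrable (fun x => w x * fderiv ℝ φ x v) volume := by
  have := h.locInt.integrable_smul_right_of_hasCompactSupport
    (g := fun x => fderiv ℝ φ x v)
    ((h1.continuous_fderiv (by simp)).clm_apply continuous_const)
    (h2.fderiv_apply (𝕜 := ℝ) v)
  simpa [smul_eq_mul] using this

theorem HasWeakGradient.integrable_right {d : ℕ} {w : Space d → ℝ} {g : Space d → Space d}
    (h : HasWeakGradient w g) {φ : Space d → ℝ} (h1 : ContDiff ℝ ∞ φ) (h2 : HasCompactSupport φ)
    (v : Space d) : Integrable (fun x => inner ℝ (g x) v * φ x) volume := by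
  have := h.locInt_grad.integrable_smul_left_of_hasCompactSupport h1.continuous h2
  refine (this.inner_const (𝕜 := ℝ) v).congr (Filter.Eventually.of_forall fun x => ?_)
  simp [real_inner_smul_left, mul_comm]

theorem HasWeakGradient.zero {d : ℕ} :
    HasWeakGradient (0 : Space d → ℝ) (0 : Space d → Space d) where
  locInt := locallyIntegrable_zero
  locInt_grad := locallyIntegrable_zero
  integral_eq φ _ _ v := by simp

theorem HasWeakGradient.add {d : ℕ} {w w' : Space d → ℝ} {g g' : Space d → Space d}
    (h : HasWeakGradient w g) (h' : HasWeakGradient w' g') :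
    HasWeakGradient (w + w') (g + g') where
  locInt := h.locInt.add h'.locInt
  locInt_grad := h.locInt_grad.add h'.locInt_grad
  integral_eq φ h1 h2 v := by
    simp only [Pi.add_apply, add_mul, inner_add_left]
    rw [integral_add (h.integrable_left h1 h2 v) (h'.integrable_left h1 h2 v),
      integral_add (h.integrable_right h1 h2 v) (h'.integrable_right h1 h2 v),
      h.integral_eq φ h1 h2 v, h'.integral_eq φ h1 h2 v]
    ring

theorem HasWeakGradient.smul {d : ℕ} {w : Space d → ℝ} {g : Space d → Space d}
    (h : HasWeakGradient w g) (c : ℝ) : HasWeakGradient (c • w) (c • g) where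
  locInt := h.locInt.smul c
  locInt_grad := h.locInt_grad.smul c
  integral_eq φ h1 h2 v := by
    simp only [Pi.smul_apply, smul_eq_mul, real_inner_smul_left, mul_assoc, integral_const_mul]
    rw [h.integral_eq φ h1 h2 v]
    ring

/-- Lebesgue measure and `|x|^{-γ} dx` have the same null sets. -/
theorem volume_absolutelyContinuous (d : ℕ) [hd : Fact (3 ≤ d)] (γ : ℝ) :
    (volume : Measure (Space d)) ≪ weightedMeasure d γ := by
  have : Nonempty (Fin d) := ⟨⟨0, by have := hd.out; omega⟩⟩
  refine withDensity_absolutelyContinuous' (by fun_prop) ?_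
  have h0 : ∀ᵐ x : Space d, x ≠ 0 := by
    simp [ae_iff]
  filter_upwards [h0] with x hx
  have : 0 < ‖x‖ ^ (-γ) := Real.rpow_pos_of_pos (norm_pos_iff.mpr hx) _
  simpa using this

instance fact_one_le_ofReal_add_one (p : ℝ) [hp : Fact (1 < p)] :
    Fact (1 ≤ ENNReal.ofReal (p + 1)) :=
  ⟨by rw [ENNReal.one_le_ofReal]; linarith [hp.out]⟩

instance fact_one_le_ofReal_two_mul (p : ℝ) [hp : Fact (1 < p)] :
    Fact (1 ≤ ENNReal.ofReal (2 * p)) :=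
  ⟨by rw [ENNReal.one_le_ofReal]; linarith [hp.out]⟩

/-- The space `H_{p,γ}(ℝ^d)` of functions `w ∈ L^{p+1}_γ` with distributional gradient in `L²`.
It is realised as the space of pairs `(w, ∇w)`; the norm inherited from the `ℓ¹` product is
`‖w‖_{p+1,γ} + ‖∇w‖_2`, see `norm_HSpace_eq`. -/
def HSpace (d : ℕ) [Fact (3 ≤ d)] (p γ : ℝ) [Fact (1 < p)] :
    Submodule ℝ (WithLp 1 (WLp d γ (p + 1) × Lp (Space d) 2 (volume : Measure (Space d)))) where
  carrier := {u | HasWeakGradient (u.fst : Space d → ℝ) (u.snd : Space d → Space d)}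
  zero_mem' := HasWeakGradient.zero.congr
    ((volume_absolutelyContinuous d γ).ae_eq (Lp.coeFn_zero _ _ _)) (Lp.coeFn_zero _ _ _)
  add_mem' {u v} hu hv := (HasWeakGradient.add hu hv).congr
    ((volume_absolutelyContinuous d γ).ae_eq (Lp.coeFn_add u.fst v.fst))
    (Lp.coeFn_add u.snd v.snd)
  smul_mem' c u hu := (HasWeakGradient.smul hu c).congr
    ((volume_absolutelyContinuous d γ).ae_eq (Lp.coeFn_smul c u.fst)) (Lp.coeFn_smul c u.snd)

section

variable {d : ℕ} [Fact (3 ≤ d)] {p γ : ℝ} [Fact (1 < p)]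

/-- The function underlying an element of `H_{p,γ}(ℝ^d)`. -/
def fn (w : HSpace d p γ) : Space d → ℝ := w.1.fst

/-- The gradient of an element of `H_{p,γ}(ℝ^d)`. -/
def grad (w : HSpace d p γ) : Space d → Space d := w.1.snd

theorem norm_WLp_eq {d : ℕ} {γ q : ℝ} (hq : 0 < q) (f : WLp d γ q) :
    ‖f‖ = wnorm q γ (f : Space d → ℝ) := by
  rw [Lp.norm_def, MemLp.eLpNorm_eq_integral_rpow_norm (by simpa using hq) (by simp) (Lp.memLp f),
    ENNReal.toReal_ofReal (by positivity), ENNReal.toReal_ofReal hq.le, wnorm, one_div]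
  congr 1
  generalize (f : Space d → ℝ) = f
  rw [weightedMeasure, integral_withDensity_eq_integral_toReal_smul (by fun_prop) (by simp)]
  refine integral_congr_ae (Filter.Eventually.of_forall fun x => ?_)
  simp only [smul_eq_mul]
  rw [ENNReal.toReal_ofReal (by positivity), mul_comm]

/-- The norm of `H_{p,γ}(ℝ^d)` is `‖w‖_{p+1,γ} + ‖∇w‖_2`. -/
theorem norm_HSpace_eq (w : HSpace d p γ) :
    ‖w‖ = wnorm (p + 1) γ (fn w) + wnorm 2 0 (grad w) := by
  have hp : (1 : ℝ) < p := Fact.out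
  have h := WithLp.prod_norm_eq_of_nat (p := 1) (n := 1) (by simp) w.1
  rw [Submodule.norm_coe] at h
  rw [h]
  simp only [pow_one, Nat.cast_one, one_div_one, Real.rpow_one]
  rw [norm_WLp_eq (by linarith)]
  congr 1
  rw [Lp.norm_def, MemLp.eLpNorm_eq_integral_rpow_norm (by simp) (by simp) (Lp.memLp _),
    ENNReal.toReal_ofReal (by positivity), wnorm, one_div]
  simp [grad]

/-- The functional `G_γ[w] = ½ ‖∇w‖_2² + 1/(p+1) ‖w‖_{p+1,γ}^{p+1}` on `H_{p,γ}(ℝ^d)`. -/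
def G (w : HSpace d p γ) : ℝ :=
  1 / 2 * wnorm 2 0 (grad w) ^ 2 + 1 / (p + 1) * wnorm (p + 1) γ (fn w) ^ (p + 1)

/-- The mass `‖w‖_{2p,γ}^{2p}`. -/
def mass (w : HSpace d p γ) : ℝ := wnorm (2 * p) γ (fn w) ^ (2 * p)

end

/-- The exponent `θ_γ`. -/
def theta (d : ℕ) (p γ : ℝ) : ℝ :=
  (d + 2 - 2 * γ - p * (d - 2)) / (d - γ - p * (d + γ - 4))

/-- The optimal constant `J_γ`, that is, the largest `C` such that
`G_γ[w] - C ‖w‖_{2p,γ}^{2 p θ_γ} ≥ 0` for all `w ∈ H_{p,γ}(ℝ^d)`. -/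
def J (d : ℕ) [Fact (3 ≤ d)] (p γ : ℝ) [Fact (1 < p)] : ℝ :=
  sSup {C : ℝ | ∀ w : HSpace d p γ,
    0 ≤ G w - C * wnorm (2 * p) γ (fn w) ^ (2 * p * theta d p γ)}

end CKN

end

/-! Compactness comes from approximating the inclusion into $L^{2p}_\gamma$, in operator norm, by
finite rank operators that replace $w$ by its averages over finitely many cells of a grid of side
$h$ (`exists_grid_approx`, `exists_finiteRank`). The ingredients are a Sobolev bound in $L^{2^*}$,
with $2^*=2d/(d-2)$, for functions in $L^{p+1}_\gamma$ with gradient in $L^2$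
(`HasWeakGradient.sobolev`), and an $L^2$ Poincaré estimate of size $h$ on the cells
(`HasWeakGradient.lintegral_sub_cellAverage_le`).

The error is estimated in three regions (`lintegral_weightedMeasure_le`). Near the origin, Hölder's
inequality pairs the Sobolev bound with a power of the weight that stays integrable exactly because
$p<2^*_\gamma/2$. On the rest of the covered region the weight is bounded, and the small $L^2$ error
is interpolated with $L^{2^*}$. Outside it nothing is subtracted, and the decay of the weight gives
smallness by interpolation between $L^{p+1}_\gamma$ and $L^{2^*}$.

The minimizer comes from the direct method: a minimizing sequence is bounded, so a subsequence
converges in $L^{2p}_\gamma$ and the mass passes to the limit. Fatou's lemma and weak compactness in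
$L^2$ make both parts of $\mathcal G_\gamma$ lower semicontinuous (`exists_limit`). Finally, a
two-parameter scaling multiplies the mass by any $m>0$ and $\mathcal G_\gamma$ by
$m^{\theta_\gamma}$ (`exists_scaled_mass`), so the minimum at one mass determines the optimal
constant (`J_eq`). -/

namespace CKN

open Filter Set
open scoped Topology Convolution

/-! ### Jensen's inequality for averages -/

section Jensen

variable {X Y F : Type*} [MeasurableSpace X] [MeasurableSpace Y] [NormedAddCommGroup F]
  [NormedSpace ℝ F]

/-- Jensen's inequality for the norm of an integral over a probability measure. -/
theorem enorm_integral_rpow_le (ν : Measure Y) [IsProbabilityMeasure ν] (f : Y → F) {q : ℝ}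
    (hq : 1 ≤ q) : ‖∫ y, f y ∂ν‖ₑ ^ q ≤ ∫⁻ y, ‖f y‖ₑ ^ q ∂ν := by
  have hq0 : 0 < q := by linarith
  by_cases hf : AEStronglyMeasurable f ν
  · have h1 : ‖∫ y, f y ∂ν‖ₑ ≤ eLpNorm' f q ν := by
      refine (enorm_integral_le_lintegral_enorm f).trans ?_
      have := eLpNorm'_le_eLpNorm'_of_exponent_le one_pos hq ν hf
      simpa [eLpNorm'] using this
    calc _ ≤ (eLpNorm' f q ν) ^ q := by gcongr
      _ = _ := by
        rw [eLpNorm', ← ENNReal.rpow_mul, one_div, inv_mul_cancel₀ hq0.ne', ENNReal.rpow_one]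
  · have : ∫ y, f y ∂ν = 0 := integral_undef fun h => hf h.1
    simp [this, hq0]

theorem lintegral_enorm_integral_rpow_le (μ : Measure X) [SFinite μ] (ν : Measure Y)
    [IsProbabilityMeasure ν] [MeasurableSpace F] [OpensMeasurableSpace F]
    (f : X → Y → F) (hf : Measurable (Function.uncurry f)) {q : ℝ}
    (hq : 1 ≤ q) : ∫⁻ x, ‖∫ y, f x y ∂ν‖ₑ ^ q ∂μ ≤ ∫⁻ y, ∫⁻ x, ‖f x y‖ₑ ^ q ∂μ ∂ν := by
  calc _ ≤ ∫⁻ x, ∫⁻ y, ‖f x y‖ₑ ^ q ∂ν ∂μ :=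
        lintegral_mono fun x => enorm_integral_rpow_le ν _ hq
    _ = _ := lintegral_lintegral_swap ((hf.enorm.pow_const q).aemeasurable)

theorem lintegral_enorm_integral_rpow_le_of_le (μ : Measure X) [SFinite μ] (ν : Measure Y)
    [IsProbabilityMeasure ν] [MeasurableSpace F] [OpensMeasurableSpace F]
    (f : X → Y → F) (hf : Measurable (Function.uncurry f)) {q : ℝ}
    (hq : 1 ≤ q) {A : ℝ≥0∞} (hA : ∀ y, ∫⁻ x, ‖f x y‖ₑ ^ q ∂μ ≤ A) :
    ∫⁻ x, ‖∫ y, f x y ∂ν‖ₑ ^ q ∂μ ≤ A := by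
  refine (lintegral_enorm_integral_rpow_le μ ν f hf hq).trans ?_
  calc _ ≤ ∫⁻ _, A ∂ν := lintegral_mono hA
    _ = A := by simp

end Jensen

/-! ### Mollification and the $L^2$ modulus of continuity -/

section Mollify

variable {d : ℕ}

/-- A mollification is an average of translates against a probability measure, so Jensen's
inequality and translation invariance bound its $L^q$ norm. -/
theorem convolution_normed_eq {F : Type*} [NormedAddCommGroup F] [NormedSpace ℝ F]
    (φ : ContDiffBump (0 : Space d)) (g : Space d → F) (x : Space d) :
    (φ.normed volume ⋆[ContinuousLinearMap.lsmul ℝ ℝ, volume] g) x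
      = ∫ t, g (x - t) ∂(volume.withDensity fun t => ENNReal.ofReal (φ.normed volume t)) := by
  rw [integral_withDensity_eq_integral_toReal_smul
    (φ.continuous_normed.measurable.ennreal_ofReal) (by simp)]
  simp [convolution, ENNReal.toReal_ofReal (φ.nonneg_normed _)]

theorem isProbabilityMeasure_normed (φ : ContDiffBump (0 : Space d)) :
    IsProbabilityMeasure
      ((volume : Measure (Space d)).withDensity fun t => ENNReal.ofReal (φ.normed volume t)) := by
  constructor
  rw [withDensity_apply _ MeasurableSet.univ, Measure.restrict_univ,
    ← ofReal_integral_eq_lintegral_ofReal φ.integrable_normed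
      (Eventually.of_forall φ.nonneg_normed), φ.integral_normed]
  simp

theorem lintegral_enorm_convolution_le {F : Type*} [NormedAddCommGroup F] [NormedSpace ℝ F]
    [MeasurableSpace F] [BorelSpace F]
    (φ : ContDiffBump (0 : Space d)) {g : Space d → F} (hg : Measurable g) {q : ℝ} (hq : 1 ≤ q) :
    ∫⁻ x, ‖(φ.normed volume ⋆[ContinuousLinearMap.lsmul ℝ ℝ, volume] g) x‖ₑ ^ q
      ≤ ∫⁻ x, ‖g x‖ₑ ^ q := by
  have := isProbabilityMeasure_normed φ
  simp_rw [convolution_normed_eq]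
  refine lintegral_enorm_integral_rpow_le_of_le _ _ (fun x t => g (x - t))
    (hg.comp measurable_sub) hq fun t => ?_
  rw [lintegral_sub_right_eq_self (fun x => ‖g x‖ₑ ^ q)]

/-- The derivative of a mollification is the mollification of the weak gradient. -/
theorem fderiv_convolution_apply {w : Space d → ℝ} {g : Space d → Space d}
    (h : HasWeakGradient w g) (φ : ContDiffBump (0 : Space d)) (x v : Space d) :
    fderiv ℝ (φ.normed volume ⋆[ContinuousLinearMap.lsmul ℝ ℝ, volume] w) x v
      = inner ℝ ((φ.normed volume ⋆[ContinuousLinearMap.lsmul ℝ ℝ, volume] g) x) v := by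
  have hφ : ContDiff ℝ ∞ (φ.normed (volume : Measure (Space d))) := φ.contDiff_normed
  have hφc : HasCompactSupport (φ.normed (volume : Measure (Space d))) :=
    φ.hasCompactSupport_normed
  have h1 := hφc.hasFDerivAt_convolution_left (ContinuousLinearMap.lsmul ℝ ℝ)
    (hφ.of_le (by simp)) h.locInt x
  rw [h1.fderiv]
  have hI := (hφc.fderiv (𝕜 := ℝ)).convolutionExists_left
    ((ContinuousLinearMap.lsmul ℝ ℝ : ℝ →L[ℝ] ℝ →L[ℝ] ℝ).precompL (Space d))
    (hφ.continuous_fderiv (by simp)) h.locInt x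
  have hI2 := hφc.convolutionExists_left (ContinuousLinearMap.lsmul ℝ ℝ)
    hφ.continuous h.locInt_grad x
  rw [convolution, ContinuousLinearMap.integral_apply hI, convolution, real_inner_comm,
    ← integral_inner hI2]
  -- The weak gradient identity is tested against the reflected and translated kernel; its inner
  -- minus sign cancels the one from integration by parts.
  have hψ : ContDiff ℝ ∞ fun t => φ.normed volume (x - t) := hφ.comp (by fun_prop)
  have hψc : HasCompactSupport fun t => φ.normed volume (x - t) :=
    hφc.comp_homeomorph (Homeomorph.subLeft x)
  have key := h.integral_eq _ hψ hψc v
  have hder : ∀ t, fderiv ℝ (fun t => φ.normed volume (x - t)) t v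
      = - fderiv ℝ (φ.normed volume) (x - t) v := by
    intro t
    have h2 : HasFDerivAt (fun t : Space d => x - t) (-ContinuousLinearMap.id ℝ (Space d)) t := by
      simpa using (hasFDerivAt_id t).const_sub x
    have h3 := ((hφ.differentiable (by simp) (x - t)).hasFDerivAt).comp t h2
    rw [show (fun t => φ.normed volume (x - t)) = φ.normed volume ∘ fun t => x - t from rfl,
      h3.fderiv]
    simp
  simp_rw [hder, mul_neg, integral_neg, neg_inj] at key
  rw [← integral_sub_left_eq_self _ volume x] at key
  rw [← integral_sub_left_eq_self (fun t => inner ℝ (g t) v * _) volume x] at key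
  simp only [sub_sub_cancel] at key
  refine Eq.trans (integral_congr_ae (Eventually.of_forall fun t => ?_))
    (key.trans (integral_congr_ae (Eventually.of_forall fun t => ?_)))
  · simp [ContinuousLinearMap.precompL_apply, mul_comm]
  · change inner ℝ (g (x - t)) v * _ = inner ℝ v (φ.normed volume t • g (x - t))
    rw [real_inner_smul_right, real_inner_comm, mul_comm]

/-- Approximation of a weakly differentiable function by smooth functions. -/
theorem HasWeakGradient.exists_smooth_approx {w : Space d → ℝ} {g : Space d → Space d}
    (h : HasWeakGradient w g) (hg : Measurable g) :
    ∃ u : ℕ → Space d → ℝ, (∀ n, ContDiff ℝ ∞ (u n)) ∧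
      (∀ᵐ x, Tendsto (fun n => u n x) atTop (𝓝 (w x))) ∧
      (∀ n, ∫⁻ x, ‖fderiv ℝ (u n) x‖ₑ ^ (2 : ℝ) ≤ ∫⁻ x, ‖g x‖ₑ ^ (2 : ℝ)) ∧
      (HasCompactSupport w → ∀ n, HasCompactSupport (u n)) := by
  -- Keeping the ratio of outer to inner radius equal to 2 lets Lebesgue differentiation give a.e.
  -- convergence for merely locally integrable $w$.
  let φ : ℕ → ContDiffBump (0 : Space d) := fun n =>
    ⟨1 / ((n : ℝ) + 1), 2 * (1 / ((n : ℝ) + 1)), by positivity, by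
      have : 0 < 1 / ((n : ℝ) + 1) := by positivity
      linarith⟩
  refine ⟨fun n => (φ n).normed volume ⋆[ContinuousLinearMap.lsmul ℝ ℝ, volume] w,
    fun n => ?_, ?_, fun n => ?_, fun hw n => ?_⟩
  · exact (φ n).hasCompactSupport_normed.contDiff_convolution_left _ (φ n).contDiff_normed h.locInt
  · refine ContDiffBump.ae_convolution_tendsto_right_of_locallyIntegrable (K := 2) ?_ ?_ h.locInt
    · have := (tendsto_one_div_add_atTop_nhds_zero_nat (𝕜 := ℝ)).const_mul 2
      rwa [mul_zero] at this
    · exact Eventually.of_forall fun n => le_rfl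
  · refine le_trans (lintegral_mono fun x => ?_)
      (lintegral_enorm_convolution_le (φ n) hg (q := 2) (by norm_num))
    gcongr
    rw [← ofReal_norm, ← ofReal_norm]
    gcongr
    refine ContinuousLinearMap.opNorm_le_bound _ (norm_nonneg _) fun v => ?_
    rw [fderiv_convolution_apply h]
    exact norm_inner_le_norm _ _
  · exact (φ n).hasCompactSupport_normed.convolution _ hw

/-- The `L²` modulus of continuity of a function with weak gradient in `L²`. -/
theorem HasWeakGradient.lintegral_translate_sub_le {w : Space d → ℝ} {g : Space d → Space d}
    (h : HasWeakGradient w g) (hg : Measurable g) (z : Space d) :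
    ∫⁻ x, ‖w (x + z) - w x‖ₑ ^ (2 : ℝ) ≤ ‖z‖ₑ ^ (2 : ℝ) * ∫⁻ x, ‖g x‖ₑ ^ (2 : ℝ) := by
  obtain ⟨u, hu, hlim, hle, -⟩ := h.exists_smooth_approx hg
  have hlim' : ∀ᵐ x, Tendsto (fun n => u n (x + z)) atTop (𝓝 (w (x + z))) :=
    (quasiMeasurePreserving_add_right volume z).ae hlim
  have hsm : ∀ n, ∫⁻ x, ‖u n (x + z) - u n x‖ₑ ^ (2 : ℝ)
      ≤ ‖z‖ₑ ^ (2 : ℝ) * ∫⁻ x, ‖g x‖ₑ ^ (2 : ℝ) := by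
    intro n
    have hcd : Continuous (fderiv ℝ (u n)) := (hu n).continuous_fderiv (by simp)
    -- The increment is an average of directional derivatives along the segment, so Jensen's
    -- inequality on $(0,1]$ applies and each translate has the same $L^2$ norm.
    have hrep : ∀ x, u n (x + z) - u n x
        = ∫ t, fderiv ℝ (u n) (x + t • z) z ∂(volume.restrict (Ioc (0 : ℝ) 1)) := by
      intro x
      have hd : ∀ t ∈ uIcc (0 : ℝ) 1, HasDerivAt (fun t : ℝ => u n (x + t • z))
          (fderiv ℝ (u n) (x + t • z) z) t := by
        intro t _
        have h1 : HasDerivAt (fun t : ℝ => x + t • z) z t := by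
          simpa using ((hasDerivAt_id t).smul_const z).const_add x
        exact (((hu n).differentiable (by simp) _).hasFDerivAt).comp_hasDerivAt t h1
      have := intervalIntegral.integral_eq_sub_of_hasDerivAt hd
        (Continuous.intervalIntegrable
          ((hcd.comp (by fun_prop)).clm_apply continuous_const) _ _)
      rw [intervalIntegral.integral_of_le zero_le_one] at this
      simpa using this.symm
    have : IsProbabilityMeasure ((volume : Measure ℝ).restrict (Ioc (0 : ℝ) 1)) := ⟨by simp⟩
    simp_rw [hrep]
    refine lintegral_enorm_integral_rpow_le_of_le _ _
      (fun x (t : ℝ) => fderiv ℝ (u n) (x + t • z) z) ?_ (by norm_num) fun t => ?_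
    · exact (Continuous.clm_apply (hcd.comp (by fun_prop)) continuous_const).measurable
    · calc ∫⁻ x, ‖fderiv ℝ (u n) (x + t • z) z‖ₑ ^ (2 : ℝ)
          ≤ ∫⁻ x, ‖z‖ₑ ^ (2 : ℝ) * ‖fderiv ℝ (u n) (x + t • z)‖ₑ ^ (2 : ℝ) := by
            refine lintegral_mono fun x => ?_
            rw [← ENNReal.mul_rpow_of_nonneg _ _ (by norm_num)]
            gcongr
            rw [mul_comm]
            exact ContinuousLinearMap.le_opENorm _ _
        _ = ‖z‖ₑ ^ (2 : ℝ) * ∫⁻ x, ‖fderiv ℝ (u n) x‖ₑ ^ (2 : ℝ) := by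
            rw [lintegral_const_mul' _ _ (by simp),
              lintegral_add_right_eq_self (fun x => ‖fderiv ℝ (u n) x‖ₑ ^ (2 : ℝ))]
        _ ≤ _ := mul_le_mul_right (hle n) _
  -- Fatou's lemma transfers the bound from the smooth approximations.
  calc ∫⁻ x, ‖w (x + z) - w x‖ₑ ^ (2 : ℝ)
      ≤ ∫⁻ x, liminf (fun n => ‖u n (x + z) - u n x‖ₑ ^ (2 : ℝ)) atTop := by
        refine lintegral_mono_ae ?_
        filter_upwards [hlim, hlim'] with x h1 h2
        have : Tendsto (fun n => ‖u n (x + z) - u n x‖ₑ ^ (2 : ℝ)) atTop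
            (𝓝 (‖w (x + z) - w x‖ₑ ^ (2 : ℝ))) :=
          (ENNReal.continuous_rpow_const.tendsto _).comp ((h2.sub h1).enorm)
        rw [this.liminf_eq]
    _ ≤ liminf (fun n => ∫⁻ x, ‖u n (x + z) - u n x‖ₑ ^ (2 : ℝ)) atTop := by
        refine lintegral_liminf_le fun n => ?_
        have := (hu n).continuous
        fun_prop
    _ ≤ _ := by
        refine (liminf_le_liminf (Eventually.of_forall hsm)).trans ?_
        simp

end Mollify

end CKN

/-! ### Cut-offs, the weight on balls and the Sobolev inequality -/

namespace CKN

open Filter Set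
open scoped Topology Convolution NNReal

variable {d : ℕ}

/-- The product rule: testing the identity for $w$ with $\chi\varphi$ produces the term
$w\,\varphi\,\nabla\chi$, which is moved to the gradient side. -/
theorem HasWeakGradient.mul_smooth {w : Space d → ℝ} {g : Space d → Space d}
    (h : HasWeakGradient w g) {χ : Space d → ℝ} (hχ : ContDiff ℝ ∞ χ) :
    HasWeakGradient (fun x => χ x * w x)
      (fun x => χ x • g x + w x • (InnerProductSpace.toDual ℝ (Space d)).symm (fderiv ℝ χ x)) where
  locInt := h.locInt.continuous_smul hχ.continuous
  locInt_grad := (h.locInt_grad.continuous_smul hχ.continuous).add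
    (h.locInt.smul_continuous ((InnerProductSpace.toDual ℝ (Space d)).symm.continuous.comp
      (hχ.continuous_fderiv (by simp))))
  integral_eq φ h1 h2 v := by
    have hχφ : ContDiff ℝ ∞ fun x => χ x * φ x := hχ.mul h1
    have hχφc : HasCompactSupport fun x => χ x * φ x := h2.mul_left
    have key := h.integral_eq _ hχφ hχφc v
    have hder : ∀ x, fderiv ℝ (fun x => χ x * φ x) x v
        = χ x * fderiv ℝ φ x v + φ x * fderiv ℝ χ x v := by
      intro x
      rw [fderiv_fun_mul (hχ.differentiable (by simp) x) (h1.differentiable (by simp) x)]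
      simp
    have i1 := h.integrable_left hχφ hχφc v
    have i2 : Integrable fun x => w x * (φ x * fderiv ℝ χ x v) := by
      have := h.locInt.integrable_smul_right_of_hasCompactSupport
        (g := fun x => φ x * fderiv ℝ χ x v)
        (h1.continuous.mul ((hχ.continuous_fderiv (by simp)).clm_apply continuous_const))
        h2.mul_right
      simpa [smul_eq_mul] using this
    have i3 := h.integrable_right hχφ hχφc v
    have e1 : ∫ x, χ x * w x * fderiv ℝ φ x v
        = (∫ x, w x * fderiv ℝ (fun x => χ x * φ x) x v) - ∫ x, w x * (φ x * fderiv ℝ χ x v) := by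
      rw [← integral_sub i1 i2]
      refine integral_congr_ae (Eventually.of_forall fun x => ?_)
      simp only [hder]
      ring
    have e2 : ∫ x, inner ℝ (χ x • g x
          + w x • (InnerProductSpace.toDual ℝ (Space d)).symm (fderiv ℝ χ x)) v * φ x
        = (∫ x, inner ℝ (g x) v * (χ x * φ x)) + ∫ x, w x * (φ x * fderiv ℝ χ x v) := by
      rw [← integral_add i3 i2]
      refine integral_congr_ae (Eventually.of_forall fun x => ?_)
      simp only [inner_add_left, real_inner_smul_left, InnerProductSpace.toDual_symm_apply]
      ring
    rw [e1, e2, key]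
    ring

/-- The critical Sobolev exponent `2^* = 2d/(d-2)`. -/
noncomputable def sobolevExp (d : ℕ) : ℝ := 2 * d / (d - 2)

/-- Mollifying preserves compact support and does not increase the $L^2$ norm of the gradient, so
the smooth Gagliardo–Nirenberg–Sobolev inequality passes to the a.e. limit by Fatou. -/
theorem HasWeakGradient.sobolev_of_hasCompactSupport (hd : 3 ≤ d) :
    ∃ C : ℝ≥0, ∀ (w : Space d → ℝ) (g : Space d → Space d), HasWeakGradient w g → Measurable g →
      HasCompactSupport w →
      eLpNorm w (ENNReal.ofReal (sobolevExp d)) volume ≤ C * eLpNorm g 2 volume := by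
  have hd' : (3 : ℝ) ≤ d := by exact_mod_cast hd
  refine ⟨eLpNormLESNormFDerivOfEqInnerConst (volume : Measure (Space d)) 2,
    fun w g h hg hw => ?_⟩
  obtain ⟨u, hu, hlim, hle, hc⟩ := h.exists_smooth_approx hg
  have h1 : ∀ n, eLpNorm (u n) (ENNReal.ofReal (sobolevExp d)) volume
      ≤ eLpNormLESNormFDerivOfEqInnerConst (volume : Measure (Space d)) 2 * eLpNorm g 2 volume := by
    intro n
    have := eLpNorm_le_eLpNorm_fderiv_of_eq_inner (volume : Measure (Space d))
      ((hu n).of_le (by simp)) (hc hw n) (p := 2) (p' := (sobolevExp d).toNNReal)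
      (by norm_num) (by simp; omega) (by
        rw [Real.coe_toNNReal _ (by unfold sobolevExp; apply div_nonneg <;> linarith)]
        have : (d : ℝ) - 2 ≠ 0 := by linarith
        simp [sobolevExp]
        field_simp)
    refine this.trans ?_
    refine mul_le_mul_right ?_ _
    have e : ((2 : ℝ≥0) : ℝ≥0∞) = 2 := rfl
    rw [e, eLpNorm_eq_lintegral_rpow_enorm_toReal (by simp) (by simp),
      eLpNorm_eq_lintegral_rpow_enorm_toReal (by simp) (by simp)]
    simp only [ENNReal.toReal_ofNat]
    gcongr ?_ ^ _
    exact hle n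
  calc _ ≤ liminf (fun n => eLpNorm (u n) (ENNReal.ofReal (sobolevExp d)) volume) atTop :=
        Lp.eLpNorm_lim_le_liminf_eLpNorm (fun n => (hu n).continuous.aestronglyMeasurable) _ hlim
    _ ≤ _ := by
      refine (liminf_le_liminf (Eventually.of_forall h1)).trans ?_
      simp

section Weight

variable {γ : ℝ}

theorem ae_ne_zero (hd : 3 ≤ d) : ∀ᵐ x : Space d, x ≠ 0 := by
  have : Nonempty (Fin d) := ⟨⟨0, by omega⟩⟩
  simp [ae_iff]

/-- Here $\rho^\gamma|x|^{-\gamma}\ge1$ on the ball; this is how weighted bounds yield unweighted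
local ones. -/
theorem restrict_ball_le_weightedMeasure (hd : 3 ≤ d) (hγ : 0 ≤ γ) {ρ : ℝ} (hρ : 0 < ρ) :
    (volume : Measure (Space d)).restrict (Metric.ball 0 ρ)
      ≤ ENNReal.ofReal (ρ ^ γ) • weightedMeasure d γ := by
  refine Measure.le_iff.2 fun s hs => ?_
  rw [Measure.restrict_apply hs, Measure.smul_apply, weightedMeasure, withDensity_apply _ hs,
    ← setLIntegral_one, smul_eq_mul, ← lintegral_const_mul' _ _ (by simp)]
  calc ∫⁻ x in s ∩ Metric.ball 0 ρ, 1
      ≤ ∫⁻ x in s ∩ Metric.ball 0 ρ, ENNReal.ofReal (ρ ^ γ) * ENNReal.ofReal (‖x‖ ^ (-γ)) := by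
        refine lintegral_mono_ae ?_
        rw [ae_restrict_iff' (hs.inter measurableSet_ball)]
        filter_upwards [ae_ne_zero hd] with x hx hxs
        have hx' : 0 < ‖x‖ := norm_pos_iff.2 hx
        have hxρ : ‖x‖ < ρ := by simpa using hxs.2
        rw [← ENNReal.ofReal_mul (by positivity), ENNReal.one_le_ofReal, Real.rpow_neg hx'.le,
          ← div_eq_mul_inv, one_le_div (by positivity)]
        exact Real.rpow_le_rpow hx'.le hxρ.le hγ
    _ ≤ _ := lintegral_mono_set inter_subset_left

theorem eLpNorm_restrict_ball_le (hd : 3 ≤ d) (hγ : 0 ≤ γ) {ρ : ℝ} (hρ : 0 < ρ) {q : ℝ}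
    (hq : 0 < q) {F : Type*} [NormedAddCommGroup F] (w : Space d → F) :
    eLpNorm w (ENNReal.ofReal q) (volume.restrict (Metric.ball 0 ρ))
      ≤ ENNReal.ofReal (ρ ^ (γ / q)) * eLpNorm w (ENNReal.ofReal q) (weightedMeasure d γ) := by
  refine (eLpNorm_mono_measure _ (restrict_ball_le_weightedMeasure hd hγ hρ)).trans ?_
  rw [eLpNorm_smul_measure_of_ne_top (by simp), ENNReal.toReal_div, ENNReal.toReal_ofReal hq.le,
    smul_eq_mul, ENNReal.toReal_one, ENNReal.ofReal_rpow_of_pos (by positivity), ← Real.rpow_mul hρ.le]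
  simp [div_eq_mul_inv]

/-- In polar coordinates the radial integrand is $y^{d-1-s}$, which is integrable at $0$ when $s<d$.
-/
theorem integrableOn_norm_rpow_neg (hd : 3 ≤ d) {s : ℝ} (hs : s < d) (r : ℝ) :
    IntegrableOn (fun x : Space d => ‖x‖ ^ (-s)) (Metric.ball 0 r) := by
  have : Nontrivial (Space d) := by
    have : Nonempty (Fin d) := ⟨⟨0, by omega⟩⟩
    infer_instance
  rcases le_or_gt r 0 with hr | hr
  · simp [Metric.ball_eq_empty.2 hr]
  rw [integrableOn_fun_norm_addHaar volume (f := fun y : ℝ => y ^ (-s))]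
  refine ((intervalIntegral.integrableOn_Ioo_rpow_iff hr (s := (d : ℝ) - 1 - s)).2
    (by linarith)).congr_fun (fun y hy => ?_) measurableSet_Ioo
  simp only [finrank_euclideanSpace, Fintype.card_fin, smul_eq_mul]
  rw [← Real.rpow_natCast, ← Real.rpow_add hy.1, Nat.cast_sub (by omega)]
  congr 1
  push_cast
  ring

theorem exists_cutoff (d : ℕ) : ∃ (K : ℝ) (χ : ℕ → Space d → ℝ), 0 ≤ K ∧
    (∀ n, ContDiff ℝ ∞ (χ n)) ∧ (∀ n, HasCompactSupport (χ n)) ∧ (∀ n x, ‖χ n x‖ ≤ 1) ∧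
    (∀ n x, ‖fderiv ℝ (χ n) x‖ ≤ K / ((n : ℝ) + 1)) ∧
    (∀ (n : ℕ) x, x ∉ Metric.ball (0 : Space d) (3 * ((n : ℝ) + 1)) → fderiv ℝ (χ n) x = 0) ∧
    ∀ x, ∀ᶠ n in atTop, χ n x = 1 := by
  obtain ⟨χ, hrIn, hrOut⟩ : ∃ χ : ContDiffBump (0 : Space d), χ.rIn = 1 ∧ χ.rOut = 2 :=
    ⟨⟨1, 2, one_pos, one_lt_two⟩, rfl, rfl⟩
  have hχ : ContDiff ℝ ∞ χ := χ.contDiff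
  have hχc : HasCompactSupport χ := χ.hasCompactSupport
  obtain ⟨K, hK⟩ := (hχc.fderiv (𝕜 := ℝ)).exists_bound_of_continuous
    (hχ.continuous_fderiv (by simp))
  have hderiv : ∀ (n : ℕ) x, fderiv ℝ (fun x => χ (((n : ℝ) + 1)⁻¹ • x)) x
      = ((n : ℝ) + 1)⁻¹ • fderiv ℝ χ (((n : ℝ) + 1)⁻¹ • x) :=
    fun n x => fderiv_comp_smul _
  have hsm : ∀ n : ℕ, ContDiff ℝ ∞ fun x : Space d => χ (((n : ℝ) + 1)⁻¹ • x) := fun n =>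
    hχ.comp (contDiff_const_smul _)
  have hcs : ∀ n : ℕ, HasCompactSupport fun x : Space d => χ (((n : ℝ) + 1)⁻¹ • x) := fun n =>
    hχc.comp_homeomorph (Homeomorph.smulOfNeZero ((n : ℝ) + 1)⁻¹ (by positivity))
  refine ⟨K, fun n x => χ (((n : ℝ) + 1)⁻¹ • x), (norm_nonneg _).trans (hK 0), hsm, hcs,
    fun n x => ?_, fun n x => ?_, fun n x hx => ?_, fun x => ?_⟩
  · rw [Real.norm_of_nonneg χ.nonneg]
    exact χ.le_one
  · rw [hderiv, norm_smul, norm_inv, Real.norm_of_nonneg (by positivity), div_eq_inv_mul]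
    gcongr
    exact hK _
  -- The rescaled bump has closed support of radius $2(n+1)$; the factor 3 leaves room for an open
  -- ball.
  · have hn : (0 : ℝ) < (n : ℝ) + 1 := by positivity
    rw [hderiv]
    have : fderiv ℝ χ (((n : ℝ) + 1)⁻¹ • x) = 0 := by
      refine image_eq_zero_of_notMem_tsupport fun hmem => hx ?_
      have h2 := (tsupport_fderiv_subset ℝ (f := χ)) hmem
      rw [χ.tsupport_eq] at h2
      simp only [Metric.mem_closedBall, dist_zero_right, norm_smul, norm_inv,
        Real.norm_of_nonneg hn.le] at h2
      rw [inv_mul_le_iff₀ hn, hrOut] at h2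
      simp only [Metric.mem_ball, dist_zero_right]
      linarith
    rw [this, smul_zero]
  · obtain ⟨N, hN⟩ := exists_nat_ge ‖x‖
    filter_upwards [eventually_ge_atTop N] with n hn
    have hn0 : (0 : ℝ) < (n : ℝ) + 1 := by positivity
    refine χ.one_of_mem_closedBall ?_
    simp only [Metric.mem_closedBall, dist_zero_right, norm_smul, norm_inv,
      Real.norm_of_nonneg hn0.le]
    rw [inv_mul_le_iff₀ hn0, hrIn]
    have h1 : (N : ℝ) ≤ n := by exact_mod_cast hn
    linarith

/-- The Sobolev inequality for functions in `L^q_γ` with gradient in `L²`. -/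
theorem HasWeakGradient.sobolev (hd : 3 ≤ d) (hγ : 0 ≤ γ) {q : ℝ} (hq : 2 ≤ q)
    (hq' : q * (d - 2) ≤ 2 * (d - γ)) :
    ∃ C : ℝ≥0, ∀ (w : Space d → ℝ) (g : Space d → Space d), HasWeakGradient w g →
      Measurable w → Measurable g →
      eLpNorm w (ENNReal.ofReal (sobolevExp d)) volume
        ≤ C * (eLpNorm w (ENNReal.ofReal q) (weightedMeasure d γ) + eLpNorm g 2 volume) := by
  obtain ⟨C₀, hC₀⟩ := HasWeakGradient.sobolev_of_hasCompactSupport hd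
  obtain ⟨K, χn, hK0, hχn, hχnc, hχ1, hK, hχ0, hχe⟩ := exists_cutoff d
  -- The exponent of the volume in Hölder's inequality from $L^q$ to $L^2$ on a ball.
  set a : ℝ := 1 / 2 - 1 / q with ha
  have hq0 : 0 < q := by linarith
  have ha0 : 0 ≤ a := by
    rw [ha, sub_nonneg]
    exact one_div_le_one_div_of_le (by norm_num) hq
  set V : ℝ≥0∞ := (volume : Measure (Space d)) (Metric.ball 0 1) with hV
  have hVfin : V ≠ ⊤ := measure_ball_lt_top.ne
  set C₁ : ℝ≥0∞ := ENNReal.ofReal (3 * K) * V ^ a with hC₁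
  have hC₁fin : C₁ ≠ ⊤ :=
    ENNReal.mul_ne_top ENNReal.ofReal_ne_top (ENNReal.rpow_ne_top_of_nonneg ha0 hVfin)
  refine ⟨C₀ * max 1 C₁.toNNReal, fun w g h hw hg => ?_⟩
  have hbound : ∀ n, eLpNorm (fun x => χn n x * w x) (ENNReal.ofReal (sobolevExp d)) volume
      ≤ C₀ * (eLpNorm g 2 volume
        + C₁ * eLpNorm w (ENNReal.ofReal q) (weightedMeasure d γ)) := by
    intro n
    set ρ : ℝ := 3 * ((n : ℝ) + 1) with hρdef
    have hn : (0 : ℝ) < (n : ℝ) + 1 := by positivity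
    have hρ : 0 < ρ := by positivity
    have hρ1 : 1 ≤ ρ := by
      have : (0 : ℝ) ≤ n := by positivity
      linarith
    have hmeas : Measurable fun x => w x •
        (InnerProductSpace.toDual ℝ (Space d)).symm (fderiv ℝ (χn n) x) :=
      hw.smul ((InnerProductSpace.toDual ℝ (Space d)).symm.continuous.comp
        ((hχn n).continuous_fderiv (by simp))).measurable
    have h1 := hC₀ _ _ (h.mul_smooth (hχn n))
      (((hχn n).continuous.measurable.smul hg).add hmeas) (hχnc n).mul_right
    refine h1.trans (mul_le_mul_right ?_ _)
    refine (eLpNorm_add_le ((hχn n).continuous.measurable.smul hg).aestronglyMeasurable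
      hmeas.aestronglyMeasurable (by norm_num)).trans (add_le_add ?_ ?_)
    · refine eLpNorm_mono fun x => ?_
      rw [Pi.smul_apply', norm_smul]
      exact mul_le_of_le_one_left (norm_nonneg _) (hχ1 n x)
    · have hpt : ∀ x, ‖w x • (InnerProductSpace.toDual ℝ (Space d)).symm (fderiv ℝ (χn n) x)‖
          ≤ K / ((n : ℝ) + 1) * ‖(Metric.ball (0 : Space d) ρ).indicator w x‖ := by
        intro x
        rw [norm_smul, LinearIsometryEquiv.norm_map]
        by_cases hx : x ∈ Metric.ball (0 : Space d) ρ
        · rw [indicator_of_mem hx, mul_comm]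
          exact mul_le_mul_of_nonneg_right (hK n x) (norm_nonneg _)
        · simp [hχ0 n x hx, hx]
      refine (eLpNorm_le_mul_eLpNorm_of_ae_le_mul (Eventually.of_forall hpt) 2).trans ?_
      rw [eLpNorm_indicator_eq_eLpNorm_restrict measurableSet_ball]
      have h2 := eLpNorm_le_eLpNorm_mul_rpow_measure_univ (p := 2) (q := ENNReal.ofReal q)
        (μ := volume.restrict (Metric.ball (0 : Space d) ρ)) (f := w)
        (by rw [← ENNReal.ofReal_ofNat]; exact ENNReal.ofReal_le_ofReal hq)
        hw.aestronglyMeasurable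
      have h3 := eLpNorm_restrict_ball_le hd hγ hρ hq0 w
      rw [Measure.restrict_apply_univ, Measure.addHaar_ball_of_pos _ _ hρ,
        ENNReal.toReal_ofReal hq0.le, ENNReal.toReal_ofNat, ← ha, ← hV,
        ENNReal.mul_rpow_of_nonneg _ _ ha0, ENNReal.ofReal_rpow_of_pos (by positivity),
        finrank_euclideanSpace, Fintype.card_fin] at h2
      -- The cut-off error carries $\rho^{-1+\gamma/q+da}$. The hypothesis $q(d-2)\le2(d-\gamma)$
      -- says that this exponent is nonpositive, so the error is bounded uniformly in $n$.
      have hreal : K / ((n : ℝ) + 1) * (ρ ^ (γ / q) * (ρ ^ d) ^ a) ≤ 3 * K := by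
        have e1 : K / ((n : ℝ) + 1) = 3 * K * ρ ^ (-1 : ℝ) := by
          rw [Real.rpow_neg_one, hρdef]
          field_simp
        rw [e1, ← Real.rpow_natCast, ← Real.rpow_mul hρ.le, ← Real.rpow_add hρ, mul_assoc,
          ← Real.rpow_add hρ]
        refine mul_le_of_le_one_right (by positivity)
          (Real.rpow_le_one_of_one_le_of_nonpos hρ1 ?_)
        have : -1 + (γ / q + d * a) = (q * (d - 2) - 2 * (d - γ)) / (2 * q) := by
          rw [ha]
          field_simp
          ring
        rw [this]
        exact div_nonpos_of_nonpos_of_nonneg (by linarith) (by linarith)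
      calc _ ≤ ENNReal.ofReal (K / ((n : ℝ) + 1)) *
            (ENNReal.ofReal (ρ ^ (γ / q)) * eLpNorm w (ENNReal.ofReal q) (weightedMeasure d γ)
              * (ENNReal.ofReal ((ρ ^ d) ^ a) * V ^ a)) := by
            gcongr
            exact h2.trans (by gcongr)
        _ = ENNReal.ofReal (K / ((n : ℝ) + 1) * (ρ ^ (γ / q) * (ρ ^ d) ^ a)) * V ^ a
              * eLpNorm w (ENNReal.ofReal q) (weightedMeasure d γ) := by
            rw [ENNReal.ofReal_mul (by positivity), ENNReal.ofReal_mul (by positivity)]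
            ring
        _ ≤ _ := by
            rw [hC₁]
            gcongr
  have hlim : ∀ x, Tendsto (fun n => χn n x * w x) atTop (𝓝 (w x)) := by
    intro x
    refine tendsto_const_nhds.congr' ?_
    filter_upwards [hχe x] with n hn
    rw [hn, one_mul]
  calc _ ≤ liminf (fun n => eLpNorm (fun x => χn n x * w x)
        (ENNReal.ofReal (sobolevExp d)) volume) atTop :=
        Lp.eLpNorm_lim_le_liminf_eLpNorm
          (fun n => ((hχn n).continuous.measurable.mul hw).aestronglyMeasurable) _
          (Eventually.of_forall hlim)
    _ ≤ C₀ * (eLpNorm g 2 volume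
        + C₁ * eLpNorm w (ENNReal.ofReal q) (weightedMeasure d γ)) := by
      refine (liminf_le_liminf (Eventually.of_forall hbound)).trans ?_
      simp
    _ ≤ _ := by
      push_cast
      rw [mul_assoc (C₀ : ℝ≥0∞) (max 1 (C₁.toNNReal : ℝ≥0∞)), ENNReal.coe_toNNReal hC₁fin,
        mul_add (max 1 C₁)]
      refine mul_le_mul_right ?_ _
      rw [add_comm]
      have e1 : C₁ * eLpNorm w (ENNReal.ofReal q) (weightedMeasure d γ)
          ≤ max 1 C₁ * eLpNorm w (ENNReal.ofReal q) (weightedMeasure d γ) := by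
        gcongr
        exact le_max_right _ _
      exact add_le_add e1 (le_mul_of_one_le_left (by simp) (le_max_left _ _))

end Weight

end CKN

/-! ### Hölder estimates near and far from the origin -/

namespace CKN

open Filter Set
open scoped Topology NNReal

variable {d : ℕ} {γ : ℝ}

theorem setLIntegral_weightedMeasure {s : Set (Space d)} (hs : MeasurableSet s)
    {f : Space d → ℝ≥0∞} (hf : Measurable f) :
    ∫⁻ x in s, f x ∂(weightedMeasure d γ)
      = ∫⁻ x in s, f x * ENNReal.ofReal (‖x‖ ^ (-γ)) := by
  rw [weightedMeasure, restrict_withDensity hs,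
    lintegral_withDensity_eq_lintegral_mul _ (by fun_prop) hf]
  simp [mul_comm]

theorem setLIntegral_norm_rpow_neg_lt_top (hd : 3 ≤ d) {s : ℝ} (hs : s < d) (r : ℝ) :
    ∫⁻ x : Space d in Metric.ball 0 r, ENNReal.ofReal (‖x‖ ^ (-s)) < ⊤ := by
  have h := (integrableOn_norm_rpow_neg hd hs r).2
  rw [hasFiniteIntegral_iff_ofReal (Eventually.of_forall fun x => by positivity)] at h
  exact h

theorem weightedMeasure_ball_lt_top (hd : 3 ≤ d) (hγ : γ < d) (r : ℝ) :
    weightedMeasure d γ (Metric.ball 0 r) < ⊤ := by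
  rw [weightedMeasure, withDensity_apply _ measurableSet_ball]
  exact setLIntegral_norm_rpow_neg_lt_top hd hγ r

/-- Absolute continuity of the integral: the power is integrable on the unit ball and small balls
have small volume. -/
theorem tendsto_setLIntegral_norm_rpow_neg (hd : 3 ≤ d) {s : ℝ} (hs : s < d) :
    Tendsto (fun r => ∫⁻ x : Space d in Metric.ball 0 r, ENNReal.ofReal (‖x‖ ^ (-s)))
      (𝓝[>] 0) (𝓝 0) := by
  have hne : Nonempty (Fin d) := ⟨⟨0, by omega⟩⟩
  have h1 := setLIntegral_norm_rpow_neg_lt_top hd hs 1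
  have h2 : Tendsto (fun r : ℝ => ((volume : Measure (Space d)).restrict (Metric.ball 0 1))
      (Metric.ball 0 r)) (𝓝[>] 0) (𝓝 0) := by
    have h3 : Tendsto (fun r : ℝ => ENNReal.ofReal (r ^ d) *
        (volume : Measure (Space d)) (Metric.ball 0 1)) (𝓝[>] 0) (𝓝 0) := by
      have h4 : Tendsto (fun r : ℝ => ENNReal.ofReal (r ^ d)) (𝓝[>] 0) (𝓝 0) := by
        have : Continuous fun r : ℝ => ENNReal.ofReal (r ^ d) :=
          ENNReal.continuous_ofReal.comp (continuous_pow d)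
        have h5 := (this.tendsto 0).mono_left (nhdsWithin_le_nhds (s := Ioi 0))
        simpa [zero_pow (by omega : d ≠ 0)] using h5
      simpa using ENNReal.Tendsto.mul_const h4 (Or.inr measure_ball_lt_top.ne)
    refine tendsto_of_tendsto_of_tendsto_of_le_of_le' tendsto_const_nhds h3
      (Eventually.of_forall fun _ => zero_le) ?_
    filter_upwards [self_mem_nhdsWithin] with r hr
    refine (Measure.restrict_apply_le _ _).trans ?_
    rw [Measure.addHaar_ball_of_pos _ _ hr]
    simp
  have h6 := tendsto_setLIntegral_zero h1.ne h2
  refine h6.congr' ?_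
  filter_upwards [Ioc_mem_nhdsGT (zero_lt_one' ℝ)] with r hr
  rw [Measure.restrict_restrict measurableSet_ball,
    inter_eq_left.2 (Metric.ball_subset_ball hr.2)]

section Holder

variable {p : ℝ}

/-- Hölder's inequality with exponents $1/a$ and $1/(1-a)$, where $a=p(d-2)/d=2p/2^*$.
Subcriticality amounts to $\gamma/(1-a)<d$, which will make the second factor vanish as $r\to0$. -/
theorem near_estimate (hd : 3 ≤ d) (hγ0 : 0 < γ) (hp1 : 1 < p) (hp : p * (d - 2) < d - γ)
    {u : Space d → ℝ} (hu : Measurable u) (r : ℝ) :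
    ∫⁻ x in Metric.ball 0 r, ‖u x‖ₑ ^ (2 * p) ∂(weightedMeasure d γ)
      ≤ (∫⁻ x, ‖u x‖ₑ ^ sobolevExp d) ^ (p * (d - 2) / d) *
        (∫⁻ x : Space d in Metric.ball 0 r,
          ENNReal.ofReal (‖x‖ ^ (-(γ / (1 - p * (d - 2) / d))))) ^ (1 - p * (d - 2) / d) := by
  have hd' : (3 : ℝ) ≤ d := by exact_mod_cast hd
  have ha0 : 0 < p * (d - 2) / d := by
    apply div_pos (mul_pos _ _) <;> linarith
  have ha1 : p * (d - 2) / d < 1 := by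
    rw [div_lt_one (by linarith)]
    linarith
  set a : ℝ := p * (d - 2) / d with ha
  have hb : 0 < 1 - a := by linarith
  rw [setLIntegral_weightedMeasure measurableSet_ball (hu.enorm.pow_const _)]
  calc _ = ∫⁻ x in Metric.ball 0 r, (‖u x‖ₑ ^ sobolevExp d) ^ a *
        (ENNReal.ofReal (‖x‖ ^ (-(γ / (1 - a))))) ^ (1 - a) := by
        refine lintegral_congr fun x => ?_
        rw [← ENNReal.rpow_mul, ENNReal.ofReal_rpow_of_nonneg (by positivity) hb.le,
          ← Real.rpow_mul (norm_nonneg _)]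
        congr 2
        · rw [ha, sobolevExp]
          have : (d : ℝ) - 2 ≠ 0 := by linarith
          field_simp
        · congr 1
          field_simp
    _ ≤ (∫⁻ x in Metric.ball 0 r, ‖u x‖ₑ ^ sobolevExp d) ^ a * (∫⁻ x : Space d in Metric.ball 0 r,
          ENNReal.ofReal (‖x‖ ^ (-(γ / (1 - a))))) ^ (1 - a) :=
        ENNReal.lintegral_mul_norm_pow_le (hu.enorm.pow_const _).aemeasurable
          (by fun_prop) ha0.le hb.le (by ring)
    _ ≤ _ := by
        gcongr
        exact Measure.restrict_le_self

/-- Hölder's inequality for $|u|^q=(|u|^a)^{1-t}(|u|^b)^t$ with $t=(q-a)/(b-a)$. -/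
theorem interpolation {X : Type*} [MeasurableSpace X] (μ : Measure X) {u : X → ℝ}
    (hu : Measurable u) {a b q : ℝ} (ha : 0 ≤ a) (haq : a ≤ q) (hqb : q < b) :
    ∫⁻ x, ‖u x‖ₑ ^ q ∂μ ≤ (∫⁻ x, ‖u x‖ₑ ^ a ∂μ) ^ (1 - (q - a) / (b - a)) *
      (∫⁻ x, ‖u x‖ₑ ^ b ∂μ) ^ ((q - a) / (b - a)) := by
  have hba : 0 < b - a := by linarith
  have ht : (q - a) / (b - a) ≤ 1 := by rw [div_le_one hba]; linarith
  have ht0 : 0 ≤ (q - a) / (b - a) := div_nonneg (by linarith) hba.le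
  refine le_trans (le_of_eq (lintegral_congr fun x => ?_))
    (ENNReal.lintegral_mul_norm_pow_le (hu.enorm.pow_const a).aemeasurable
      (hu.enorm.pow_const b).aemeasurable (sub_nonneg.2 ht) ht0 (by ring))
  rw [← ENNReal.rpow_mul, ← ENNReal.rpow_mul, ← ENNReal.rpow_add_of_nonneg _ _
    (mul_nonneg ha (sub_nonneg.2 ht)) (mul_nonneg (by linarith) ht0)]
  congr 1
  field_simp
  ring

theorem setLIntegral_compl_ball_le (hγ0 : 0 < γ) {r : ℝ} (hr : 0 < r) {f : Space d → ℝ≥0∞}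
    (hf : Measurable f) {s : Set (Space d)} (hs : MeasurableSet s)
    (hsr : Disjoint s (Metric.ball 0 r)) :
    ∫⁻ x in s, f x ∂(weightedMeasure d γ) ≤ ENNReal.ofReal (r ^ (-γ)) * ∫⁻ x in s, f x := by
  rw [setLIntegral_weightedMeasure hs hf, ← lintegral_const_mul' _ _ (by simp)]
  refine setLIntegral_mono (by fun_prop) fun x hx => ?_
  rw [mul_comm]
  refine mul_le_mul_left (ENNReal.ofReal_le_ofReal ?_) _
  have hxr : r ≤ ‖x‖ := by
    by_contra h
    exact (Set.disjoint_left.1 hsr hx) (by simpa using h)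
  exact Real.rpow_le_rpow_of_nonpos hr hxr (neg_nonpos.2 hγ0.le)

/-- The three terms are the ball of radius $r$, the rest of $s$, and the complement of $s$. The
weight is at most $r^{-\gamma}$ on the second region and at most $R^{-\gamma}$ on the third. In the
application $u$ is the error of the grid approximation of $w$ and $s$ the union of the chosen cells.
-/
theorem lintegral_weightedMeasure_le (hd : 3 ≤ d) (hγ0 : 0 < γ) (hp1 : 1 < p)
    (hp : p * (d - 2) < d - γ)
    {u w : Space d → ℝ} (hu : Measurable u) (hw : Measurable w) {s : Set (Space d)}
    (hs : MeasurableSet s)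
    {r R : ℝ} (hr : 0 < r) (hR : 0 < R) (hsR : Metric.ball 0 R ⊆ s) (huw : ∀ x, x ∉ s → u x = w x) :
    ∫⁻ x, ‖u x‖ₑ ^ (2 * p) ∂(weightedMeasure d γ)
      ≤ (∫⁻ x, ‖u x‖ₑ ^ sobolevExp d) ^ (p * (d - 2) / d) *
        (∫⁻ x : Space d in Metric.ball 0 r,
          ENNReal.ofReal (‖x‖ ^ (-(γ / (1 - p * (d - 2) / d))))) ^ (1 - p * (d - 2) / d)
      + ENNReal.ofReal (r ^ (-γ)) *
        ((∫⁻ x in s, ‖u x‖ₑ ^ (2 : ℝ)) ^ (1 - (2 * p - 2) / (sobolevExp d - 2)) *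
          (∫⁻ x, ‖u x‖ₑ ^ sobolevExp d) ^ ((2 * p - 2) / (sobolevExp d - 2)))
      + (∫⁻ x, ‖w x‖ₑ ^ (p + 1) ∂(weightedMeasure d γ))
            ^ (1 - (2 * p - (p + 1)) / (sobolevExp d - (p + 1))) *
          (ENNReal.ofReal (R ^ (-γ)) * ∫⁻ x, ‖w x‖ₑ ^ sobolevExp d)
            ^ ((2 * p - (p + 1)) / (sobolevExp d - (p + 1))) := by
  have hd' : (3 : ℝ) ≤ d := by exact_mod_cast hd
  have hQ : 2 * p < sobolevExp d := by
    rw [sobolevExp, lt_div_iff₀ (by linarith)]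
    linarith
  have hexp : 0 ≤ (2 * p - (p + 1)) / (sobolevExp d - (p + 1)) :=
    div_nonneg (by linarith) (by linarith)
  have hexp1 : (2 * p - (p + 1)) / (sobolevExp d - (p + 1)) ≤ 1 := by
    rw [div_le_one (by linarith)]; linarith
  have hfu : Measurable fun x => ‖u x‖ₑ ^ (2 * p) := hu.enorm.pow_const _
  have hcover : (univ : Set (Space d)) ⊆ (Metric.ball 0 r ∪ (s \ Metric.ball 0 r)) ∪ sᶜ := by
    intro x _
    by_cases h1 : x ∈ Metric.ball (0 : Space d) r <;> by_cases h2 : x ∈ s <;> simp_all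
  have hsplit : ∫⁻ x, ‖u x‖ₑ ^ (2 * p) ∂(weightedMeasure d γ)
      ≤ ∫⁻ x in Metric.ball 0 r, ‖u x‖ₑ ^ (2 * p) ∂(weightedMeasure d γ)
        + ∫⁻ x in s \ Metric.ball 0 r, ‖u x‖ₑ ^ (2 * p) ∂(weightedMeasure d γ)
        + ∫⁻ x in sᶜ, ‖u x‖ₑ ^ (2 * p) ∂(weightedMeasure d γ) := by
    rw [← setLIntegral_univ]
    refine (lintegral_mono_set hcover).trans ((lintegral_union_le _ _ _).trans ?_)
    gcongr
    exact lintegral_union_le _ _ _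
  refine hsplit.trans (add_le_add (add_le_add (near_estimate hd hγ0 hp1 hp hu r) ?_) ?_)
  · refine (setLIntegral_compl_ball_le hγ0 hr hfu (hs.diff measurableSet_ball)
      disjoint_sdiff_left).trans ?_
    refine mul_le_mul_right ?_ _
    refine (lintegral_mono_set sdiff_subset).trans ?_
    refine (interpolation (volume.restrict s) hu (by norm_num : (0 : ℝ) ≤ 2) (by linarith)
      hQ).trans ?_
    refine mul_le_mul_right (ENNReal.rpow_le_rpow (setLIntegral_le_lintegral _ _) ?_) _
    exact div_nonneg (by linarith) (by linarith)
  · have hcongr : ∫⁻ x in sᶜ, ‖u x‖ₑ ^ (2 * p) ∂(weightedMeasure d γ)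
        = ∫⁻ x in sᶜ, ‖w x‖ₑ ^ (2 * p) ∂(weightedMeasure d γ) :=
      setLIntegral_congr_fun hs.compl fun x hx => by simp only [huw x hx]
    rw [hcongr]
    refine (interpolation ((weightedMeasure d γ).restrict sᶜ) hw (by linarith : (0 : ℝ) ≤ p + 1)
      (by linarith) hQ).trans ?_
    refine mul_le_mul' (ENNReal.rpow_le_rpow (setLIntegral_le_lintegral _ _) (by linarith))
      (ENNReal.rpow_le_rpow ?_ hexp)
    refine (setLIntegral_compl_ball_le hγ0 hR (hw.enorm.pow_const _) hs.compl
      (disjoint_compl_left_iff_subset.2 hsR)).trans ?_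
    exact mul_le_mul_right (setLIntegral_le_lintegral _ _) _

end Holder

/-- Functions in `L^q_γ` are integrable on balls, with a bound. -/
theorem exists_setLIntegral_ball_le (hd : 3 ≤ d) (hγ0 : 0 ≤ γ) {q : ℝ} (hq : 1 ≤ q)
    {ρ : ℝ} (hρ : 0 < ρ) :
    ∃ C : ℝ≥0, ∀ w : Space d → ℝ, AEStronglyMeasurable w volume →
      ∫⁻ x in Metric.ball 0 ρ, ‖w x‖ₑ
        ≤ C * eLpNorm w (ENNReal.ofReal q) (weightedMeasure d γ) := by
  have hq0 : 0 < q := by linarith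
  set c : ℝ≥0∞ := (volume : Measure (Space d)) (Metric.ball 0 ρ) ^ (1 - 1 / q) with hc
  have hcfin : c ≠ ⊤ := ENNReal.rpow_ne_top_of_nonneg
    (sub_nonneg.2 ((div_le_one hq0).2 hq)) measure_ball_lt_top.ne
  refine ⟨Real.toNNReal (ρ ^ (γ / q)) * c.toNNReal, fun w hw => ?_⟩
  have h2 := eLpNorm_le_eLpNorm_mul_rpow_measure_univ (p := 1) (q := ENNReal.ofReal q)
    (μ := volume.restrict (Metric.ball (0 : Space d) ρ)) (f := w)
    (by rwa [ENNReal.one_le_ofReal]) hw.restrict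
  have h3 := eLpNorm_restrict_ball_le hd hγ0 hρ hq0 w
  rw [eLpNorm_one_eq_lintegral_enorm, Measure.restrict_apply_univ, ENNReal.toReal_ofReal hq0.le,
    ENNReal.toReal_one, div_one, ← hc] at h2
  refine h2.trans ((mul_le_mul_left h3 _).trans (le_of_eq ?_))
  push_cast
  rw [ENNReal.coe_toNNReal hcfin]
  change _ = ENNReal.ofReal (ρ ^ (γ / q)) * c * _
  ring

end CKN

/-! ### Grid cells, cell averages and the Poincaré estimate -/

namespace CKN

open Filter Set
open scoped Topology NNReal

variable {d : ℕ}

/-- The index of the cell of the grid `h ℤ^d` that contains `x`. -/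
noncomputable def cellIndex (h : ℝ) (x : Space d) : Fin d → ℤ := fun i => ⌊x i / h⌋

/-- The half-open cube of side `h` with index `k`. -/
def cell (h : ℝ) (k : Fin d → ℤ) : Set (Space d) := {x | cellIndex h x = k}

theorem measurable_cellIndex (h : ℝ) : Measurable (cellIndex h : Space d → Fin d → ℤ) :=
  measurable_pi_lambda _ fun i => Int.measurable_floor.comp (by fun_prop)

theorem measurableSet_cell (h : ℝ) (k : Fin d → ℤ) : MeasurableSet (cell h k) :=
  measurable_cellIndex h (measurableSet_singleton k)

theorem volume_cell {h : ℝ} (hh : 0 < h) (k : Fin d → ℤ) :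
    volume (cell h k) = ENNReal.ofReal h ^ d := by
  have h1 : cell h k = (WithLp.ofLp : Space d → Fin d → ℝ) ⁻¹'
      (Set.pi univ fun i => Ico (h * k i) (h * k i + h)) := by
    ext x
    simp only [cell, cellIndex, mem_ofPred_eq, funext_iff, mem_preimage, Set.mem_pi, mem_univ,
      true_imp_iff, mem_Ico, Int.floor_eq_iff, le_div_iff₀ hh, div_lt_iff₀ hh]
    refine forall_congr' fun i => ?_
    rw [mul_comm, add_mul, one_mul, mul_comm (k i : ℝ)]
  rw [h1, (PiLp.volume_preserving_ofLp (Fin d)).measure_preimage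
    (MeasurableSet.univ_pi fun i => measurableSet_Ico).nullMeasurableSet, Real.volume_pi_Ico]
  simp

theorem norm_sub_lt_of_cellIndex_eq {h : ℝ} (hh : 0 < h) {x y : Space d}
    (hxy : cellIndex h x = cellIndex h y) : ‖y - x‖ < (d + 1) * h := by
  have h1 : ∀ i, |y i - x i| ≤ h := by
    intro i
    have h2 := congrFun hxy i
    simp only [cellIndex] at h2
    have h3 := Int.abs_sub_lt_one_of_floor_eq_floor h2.symm
    rw [← sub_div, abs_div, abs_of_pos hh, div_lt_one hh] at h3
    exact h3.le
  -- The crude bound $\sqrt d\le d$ suffices; the additional $h$ in the conclusion makes the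
  -- inequality strict.
  have h4 : ‖y - x‖ ≤ d * h := by
    rw [EuclideanSpace.norm_eq]
    refine Real.sqrt_le_iff.2 ⟨by positivity, ?_⟩
    calc ∑ i, ‖(y - x) i‖ ^ 2 ≤ ∑ _i : Fin d, h ^ 2 := by
          refine Finset.sum_le_sum fun i _ => ?_
          have := h1 i
          gcongr
          simpa using this
      _ = d * h ^ 2 := by simp
      _ ≤ (d * h) ^ 2 := by
          rw [mul_pow]
          have : (d : ℝ) ≤ (d : ℝ) ^ 2 := by
            rcases Nat.eq_zero_or_pos d with h0 | h0
            · simp [h0]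
            · have : (1 : ℝ) ≤ d := by exact_mod_cast h0
              nlinarith
          gcongr
  linarith

/-- The ratio of the volumes of a ball of radius `(d + 1) h` and of a cell of side `h`. -/
noncomputable def ballCellRatio (d : ℕ) : ℝ≥0∞ :=
  ENNReal.ofReal ((d + 1 : ℝ) ^ d) * (volume : Measure (Space d)) (Metric.ball 0 1)

theorem ballCellRatio_ne_top (d : ℕ) : ballCellRatio d ≠ ⊤ :=
  ENNReal.mul_ne_top ENNReal.ofReal_ne_top measure_ball_lt_top.ne

theorem volume_ball_eq {h : ℝ} (hh : 0 < h) :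
    (volume : Measure (Space d)) (Metric.ball 0 ((d + 1) * h))
      = ballCellRatio d * ENNReal.ofReal h ^ d := by
  rw [Measure.addHaar_ball_of_pos _ _ (by positivity), finrank_euclideanSpace, Fintype.card_fin,
    mul_pow, ENNReal.ofReal_mul (by positivity), ENNReal.ofReal_pow hh.le, ballCellRatio]
  ring

/-- `Lᵖ` bound for averages over the cells of a grid. -/
theorem lintegral_cell_average_le {h : ℝ} (hh : 0 < h) (f : Space d → Space d → ℝ)
    (hf : Measurable (Function.uncurry f)) {q : ℝ} (hq : 1 ≤ q) {A : ℝ≥0∞}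
    (hA : ∀ z ∈ Metric.ball (0 : Space d) ((d + 1) * h), ∫⁻ x, ‖f x (x + z)‖ₑ ^ q ≤ A) :
    ∫⁻ x, ‖(h ^ d)⁻¹ * ∫ y in cell h (cellIndex h x), f x y‖ₑ ^ q ≤ ballCellRatio d * A := by
  have hv0 : ENNReal.ofReal h ^ d ≠ 0 := pow_ne_zero _ (by simpa using hh)
  have hvt : ENNReal.ofReal h ^ d ≠ ⊤ := ENNReal.pow_ne_top ENNReal.ofReal_ne_top
  have hpt : ∀ x, ‖(h ^ d)⁻¹ * ∫ y in cell h (cellIndex h x), f x y‖ₑ ^ q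
      ≤ (ENNReal.ofReal h ^ d)⁻¹ * ∫⁻ z in Metric.ball (0 : Space d) ((d + 1) * h),
        ‖f x (x + z)‖ₑ ^ q := by
    intro x
    have hprob : IsProbabilityMeasure ((ENNReal.ofReal h ^ d)⁻¹ •
        (volume : Measure (Space d)).restrict (cell h (cellIndex h x))) := by
      constructor
      rw [Measure.smul_apply, Measure.restrict_apply_univ, volume_cell hh, smul_eq_mul,
        ENNReal.inv_mul_cancel hv0 hvt]
    have e1 : (h ^ d)⁻¹ * ∫ y in cell h (cellIndex h x), f x y
        = ∫ y, f x y ∂((ENNReal.ofReal h ^ d)⁻¹ •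
          (volume : Measure (Space d)).restrict (cell h (cellIndex h x))) := by
      rw [integral_smul_measure, smul_eq_mul, ENNReal.toReal_inv, ENNReal.toReal_pow,
        ENNReal.toReal_ofReal hh.le]
    rw [e1]
    refine (enorm_integral_rpow_le _ _ hq).trans ?_
    rw [lintegral_smul_measure, smul_eq_mul]
    refine mul_le_mul_right ?_ _
    -- With $z=y-x$ the domain of integration is enlarged to a ball that does not depend on $x$,
    -- which allows Tonelli's theorem to exchange the integrals. The price is the volume ratio
    -- `ballCellRatio d`.
    have hsub : cell h (cellIndex h x) ⊆ (fun y => -x + y) ⁻¹'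
        Metric.ball (0 : Space d) ((d + 1) * h) := by
      intro y hy
      have := norm_sub_lt_of_cellIndex_eq hh (x := x) (y := y) hy.symm
      simpa [neg_add_eq_sub] using this
    refine (lintegral_mono_set hsub).trans (le_of_eq ?_)
    have := (measurePreserving_add_left (volume : Measure (Space d)) (-x)).setLIntegral_comp_preimage
      (s := Metric.ball (0 : Space d) ((d + 1) * h)) measurableSet_ball
      (f := fun z => ‖f x (x + z)‖ₑ ^ q)
      ((hf.comp (by fun_prop : Measurable fun z : Space d => (x, x + z))).enorm.pow_const q)
    rw [← this]
    simp
  calc _ ≤ ∫⁻ x, (ENNReal.ofReal h ^ d)⁻¹ * ∫⁻ z in Metric.ball (0 : Space d) ((d + 1) * h),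
        ‖f x (x + z)‖ₑ ^ q := lintegral_mono hpt
    _ = (ENNReal.ofReal h ^ d)⁻¹ * ∫⁻ z in Metric.ball (0 : Space d) ((d + 1) * h),
        ∫⁻ x, ‖f x (x + z)‖ₑ ^ q := by
      rw [lintegral_const_mul' _ _ (ENNReal.inv_ne_top.2 hv0), lintegral_lintegral_swap]
      exact ((hf.comp (by fun_prop : Measurable fun z : Space d × Space d =>
        (z.1, z.1 + z.2))).enorm.pow_const q).aemeasurable
    _ ≤ (ENNReal.ofReal h ^ d)⁻¹ * ∫⁻ _z in Metric.ball (0 : Space d) ((d + 1) * h), A :=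
      mul_le_mul_right (setLIntegral_mono measurable_const hA) _
    _ = _ := by
      rw [setLIntegral_const, volume_ball_eq hh]
      calc (ENNReal.ofReal h ^ d)⁻¹ * (A * (ballCellRatio d * ENNReal.ofReal h ^ d))
          = ((ENNReal.ofReal h ^ d)⁻¹ * ENNReal.ofReal h ^ d) * (ballCellRatio d * A) := by ring
        _ = _ := by rw [ENNReal.inv_mul_cancel hv0 hvt, one_mul]

/-- The average of `w` over the cell that contains `x`. -/
noncomputable def cellAverage (h : ℝ) (w : Space d → ℝ) (x : Space d) : ℝ :=
  (h ^ d)⁻¹ * ∫ y in cell h (cellIndex h x), w y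

theorem lintegral_cellAverage_le {h : ℝ} (hh : 0 < h) {w : Space d → ℝ} (hw : Measurable w)
    {q : ℝ} (hq : 1 ≤ q) :
    ∫⁻ x, ‖cellAverage h w x‖ₑ ^ q ≤ ballCellRatio d * ∫⁻ x, ‖w x‖ₑ ^ q := by
  refine lintegral_cell_average_le hh (fun _ y => w y) (hw.comp measurable_snd) hq fun z _ => ?_
  rw [lintegral_add_right_eq_self (fun x => ‖w x‖ₑ ^ q)]

theorem integrableOn_cell {h : ℝ} (hh : 0 < h) {w : Space d → ℝ}
    (hw : LocallyIntegrable w volume) (k : Fin d → ℤ) : IntegrableOn w (cell h k) := by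
  rcases (cell (d := d) h k).eq_empty_or_nonempty with h0 | ⟨x, hx⟩
  · simp [h0]
  · refine (hw.integrableOn_isCompact (isCompact_closedBall x ((d + 1) * h))).mono_set ?_
    intro y hy
    have := norm_sub_lt_of_cellIndex_eq hh (x := x) (y := y) (hx.trans hy.symm)
    rw [Metric.mem_closedBall, dist_eq_norm]
    exact this.le

/-- The difference is the cell average of $w(x)-w(y)$, and only translations of length below
$(d+1)h$ occur, each controlled by the $L^2$ modulus of continuity. -/
theorem HasWeakGradient.lintegral_sub_cellAverage_le {h : ℝ} (hh : 0 < h) {w : Space d → ℝ}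
    {g : Space d → Space d} (hwg : HasWeakGradient w g) (hw : Measurable w) (hg : Measurable g) :
    ∫⁻ x, ‖w x - cellAverage h w x‖ₑ ^ (2 : ℝ)
      ≤ ballCellRatio d * (ENNReal.ofReal ((d + 1) * h) ^ (2 : ℝ) * ∫⁻ x, ‖g x‖ₑ ^ (2 : ℝ)) := by
  have e : ∀ x, w x - cellAverage h w x
      = (h ^ d)⁻¹ * ∫ y in cell h (cellIndex h x), (w x - w y) := by
    intro x
    rw [integral_sub, cellAverage, setIntegral_const, Measure.real, volume_cell hh,
      ENNReal.toReal_pow, ENNReal.toReal_ofReal hh.le, smul_eq_mul, mul_sub,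
      inv_mul_cancel_left₀ (by positivity)]
    · refine integrableOn_const ?_
      rw [volume_cell hh]
      exact ENNReal.pow_ne_top ENNReal.ofReal_ne_top
    · exact integrableOn_cell hh hwg.locInt _
  simp_rw [e]
  refine lintegral_cell_average_le hh (fun x y => w x - w y)
    ((hw.comp measurable_fst).sub (hw.comp measurable_snd)) (by norm_num) fun z hz => ?_
  have h1 := hwg.lintegral_translate_sub_le hg z
  calc ∫⁻ x, ‖w x - w (x + z)‖ₑ ^ (2 : ℝ) = ∫⁻ x, ‖w (x + z) - w x‖ₑ ^ (2 : ℝ) := by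
        simp_rw [enorm_sub_rev]
    _ ≤ _ := h1
    _ ≤ _ := by
      gcongr
      rw [← ofReal_norm]
      refine ENNReal.ofReal_le_ofReal ?_
      have : ‖z‖ < (d + 1) * h := by simpa using hz
      exact this.le

/-- A finite set of cell indices that covers the ball of radius `R`. -/
theorem exists_finset_cellIndex (d : ℕ) {h : ℝ} (hh : 0 < h) (R : ℝ) :
    ∃ s : Finset (Fin d → ℤ), ∀ x ∈ Metric.ball (0 : Space d) R, cellIndex h x ∈ s := by
  refine ⟨Fintype.piFinset fun _ => Finset.Icc ⌊-R / h⌋ ⌊R / h⌋, fun x hx => ?_⟩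
  rw [Fintype.mem_piFinset]
  intro i
  have h1 : |x i| ≤ R := by
    have := PiLp.norm_apply_le x i
    have h2 : ‖x‖ < R := by simpa using hx
    exact (this.trans h2.le)
  rw [Finset.mem_Icc]
  rw [abs_le] at h1
  exact ⟨Int.floor_le_floor (by gcongr; exact h1.1), Int.floor_le_floor (by gcongr; exact h1.2)⟩

end CKN

/-! ### Finite rank averaging operators -/

namespace CKN

open Filter Set
open scoped Topology NNReal

section HSpace

variable {d : ℕ} [hd : Fact (3 ≤ d)] {p γ : ℝ} [hp1 : Fact (1 < p)]

theorem measurable_fn (w : HSpace d p γ) : Measurable (fn w) :=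
  (Lp.stronglyMeasurable w.1.fst).measurable

theorem measurable_grad (w : HSpace d p γ) : Measurable (grad w) :=
  (Lp.stronglyMeasurable w.1.snd).measurable

theorem hasWeakGradient (w : HSpace d p γ) : HasWeakGradient (fn w) (grad w) := w.2

theorem norm_eq_add (w : HSpace d p γ) : ‖w‖ = ‖w.1.fst‖ + ‖w.1.snd‖ :=
  WithLp.prod_norm_eq_of_L1 w.1

theorem eLpNorm_fn_le (w : HSpace d p γ) :
    eLpNorm (fn w) (ENNReal.ofReal (p + 1)) (weightedMeasure d γ) ≤ ENNReal.ofReal ‖w‖ := by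
  have h := Lp.enorm_def w.1.fst
  rw [fn, ← h, ← ofReal_norm]
  refine ENNReal.ofReal_le_ofReal ?_
  rw [norm_eq_add]
  exact le_add_of_nonneg_right (norm_nonneg _)

theorem eLpNorm_grad_le (w : HSpace d p γ) :
    eLpNorm (grad w) 2 volume ≤ ENNReal.ofReal ‖w‖ := by
  have h := Lp.enorm_def w.1.snd
  rw [grad, ← h, ← ofReal_norm]
  refine ENNReal.ofReal_le_ofReal ?_
  rw [norm_eq_add]
  exact le_add_of_nonneg_left (norm_nonneg _)

theorem fn_add (v w : HSpace d p γ) : fn (v + w) =ᵐ[weightedMeasure d γ] fn v + fn w :=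
  Lp.coeFn_add v.1.fst w.1.fst

theorem fn_smul (c : ℝ) (w : HSpace d p γ) : fn (c • w) =ᵐ[weightedMeasure d γ] c • fn w :=
  Lp.coeFn_smul c w.1.fst

theorem weightedMeasure_absolutelyContinuous (d : ℕ) (γ : ℝ) : weightedMeasure d γ ≪ volume :=
  withDensity_absolutelyContinuous _ _

theorem ae_volume_of_ae_weightedMeasure {P : Space d → Prop}
    (h : ∀ᵐ x ∂(weightedMeasure d γ), P x) : ∀ᵐ x, P x :=
  (volume_absolutelyContinuous d γ).ae_le h

theorem lintegral_rpow_enorm_le_of_eLpNorm_le {X F : Type*} [MeasurableSpace X]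
    [NormedAddCommGroup F] {μ : Measure X} {f : X → F} {q : ℝ} (hq : 0 < q) {A : ℝ≥0∞}
    (h : eLpNorm f (ENNReal.ofReal q) μ ≤ A) : ∫⁻ x, ‖f x‖ₑ ^ q ∂μ ≤ A ^ q := by
  rw [eLpNorm_eq_lintegral_rpow_enorm_toReal (by simpa using hq) (by simp),
    ENNReal.toReal_ofReal hq.le] at h
  have := ENNReal.rpow_le_rpow h hq.le
  rwa [← ENNReal.rpow_mul, one_div, inv_mul_cancel₀ hq.ne', ENNReal.rpow_one] at this

theorem eLpNorm_le_of_lintegral_rpow_enorm_le {X F : Type*} [MeasurableSpace X]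
    [NormedAddCommGroup F] {μ : Measure X} {f : X → F} {q : ℝ} (hq : 0 < q) {A : ℝ≥0∞}
    (h : ∫⁻ x, ‖f x‖ₑ ^ q ∂μ ≤ A ^ q) : eLpNorm f (ENNReal.ofReal q) μ ≤ A := by
  rw [eLpNorm_eq_lintegral_rpow_enorm_toReal (by simpa using hq) (by simp),
    ENNReal.toReal_ofReal hq.le]
  have := ENNReal.rpow_le_rpow h (by positivity : 0 ≤ 1 / q)
  rwa [← ENNReal.rpow_mul, mul_one_div, div_self hq.ne', ENNReal.rpow_one] at this

/-- The integral over a cell as a continuous functional on `H_{p,γ}`. -/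
theorem exists_cell_functional (hγ0 : 0 < γ) {h : ℝ} (hh : 0 < h) (k : Fin d → ℤ) :
    ∃ l : HSpace d p γ →L[ℝ] ℝ, ∀ w, l w = (h ^ d)⁻¹ * ∫ y in cell h k, fn w y := by
  have hp := hp1.out
  have hint : ∀ w : HSpace d p γ, IntegrableOn (fn w) (cell h k) := fun w =>
    integrableOn_cell hh (hasWeakGradient w).locInt k
  obtain ⟨ρ, hρ, hsub⟩ : ∃ ρ : ℝ, 0 < ρ ∧ cell h k ⊆ Metric.ball (0 : Space d) ρ := by
    rcases (cell (d := d) h k).eq_empty_or_nonempty with h0 | ⟨x, hx⟩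
    · exact ⟨1, one_pos, by simp [h0]⟩
    · refine ⟨‖x‖ + (d + 1) * h, by positivity, fun y hy => ?_⟩
      have h1 := norm_sub_lt_of_cellIndex_eq hh (x := x) (y := y) (hx.trans hy.symm)
      have h2 : ‖y‖ ≤ ‖x‖ + ‖y - x‖ := by
        simpa using norm_add_le x (y - x)
      rw [Metric.mem_ball, dist_zero_right]
      linarith
  obtain ⟨C, hC⟩ := exists_setLIntegral_ball_le hd.out hγ0.le
    (by linarith : (1 : ℝ) ≤ p + 1) hρ
  let l : HSpace d p γ →ₗ[ℝ] ℝ :=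
    { toFun := fun w => (h ^ d)⁻¹ * ∫ y in cell h k, fn w y
      map_add' := fun v w => by
        rw [← mul_add, ← integral_add (hint v) (hint w)]
        congr 1
        refine integral_congr_ae (ae_restrict_of_ae (ae_volume_of_ae_weightedMeasure (γ := γ) ?_))
        exact fn_add v w
      map_smul' := fun c w => by
        have : ∫ y in cell h k, fn (c • w) y = ∫ y in cell h k, c * fn w y := by
          refine integral_congr_ae
            (ae_restrict_of_ae (ae_volume_of_ae_weightedMeasure (γ := γ) ?_))
          exact fn_smul c w
        rw [this, integral_const_mul, RingHom.id_apply, smul_eq_mul]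
        ring }
  refine ⟨l.mkContinuous ((h ^ d)⁻¹ * C) fun w => ?_, fun w => rfl⟩
  change ‖(h ^ d)⁻¹ * ∫ y in cell h k, fn w y‖ ≤ _
  rw [norm_mul, Real.norm_of_nonneg (by positivity), mul_assoc]
  refine mul_le_mul_of_nonneg_left ?_ (by positivity)
  have h1 : ‖∫ y in cell h k, fn w y‖ₑ ≤ C * ENNReal.ofReal ‖w‖ := by
    calc _ ≤ ∫⁻ y in cell h k, ‖fn w y‖ₑ := enorm_integral_le_lintegral_enorm _
      _ ≤ ∫⁻ y in Metric.ball 0 ρ, ‖fn w y‖ₑ := lintegral_mono_set hsub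
      _ ≤ _ := hC _ (measurable_fn w).aestronglyMeasurable
      _ ≤ _ := mul_le_mul_right (eLpNorm_fn_le w) _
  rw [← ofReal_norm, ← ENNReal.ofReal_coe_nnreal, ← ENNReal.ofReal_mul (by positivity)] at h1
  exact (ENNReal.ofReal_le_ofReal_iff (by positivity)).1 h1

theorem weightedMeasure_cell_ne_top (hγ : γ < d) {h : ℝ} (hh : 0 < h) (k : Fin d → ℤ) :
    weightedMeasure d γ (cell h k) ≠ ⊤ := by
  rcases (cell (d := d) h k).eq_empty_or_nonempty with h0 | ⟨x, hx⟩
  · simp [h0]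
  · refine ((measure_mono fun y hy => ?_).trans_lt
      (weightedMeasure_ball_lt_top hd.out hγ (‖x‖ + (d + 1) * h))).ne
    have h1 := norm_sub_lt_of_cellIndex_eq hh (x := x) (y := y) (hx.trans hy.symm)
    have h2 : ‖y‖ ≤ ‖x‖ + ‖y - x‖ := by
      simpa using norm_add_le x (y - x)
    rw [Metric.mem_ball, dist_zero_right]
    linarith

/-- The finite rank operator that averages over finitely many cells. -/
theorem exists_finiteRank (hγ0 : 0 < γ) (hγ : γ < d) {h : ℝ} (hh : 0 < h)
    (s : Finset (Fin d → ℤ)) :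
    ∃ T : HSpace d p γ →L[ℝ] WLp d γ (2 * p), IsCompactOperator T ∧
      ∀ w, T w =ᵐ[weightedMeasure d γ]
        fun x => if cellIndex h x ∈ s then cellAverage h (fn w) x else 0 := by
  classical
  induction s using Finset.induction_on with
  | empty =>
    refine ⟨0, isCompactOperator_zero, fun w => ?_⟩
    filter_upwards [Lp.coeFn_zero ℝ (ENNReal.ofReal (2 * p)) (weightedMeasure d γ)] with x hx
    simpa using hx
  | insert k s hk ih =>
    obtain ⟨T, hT, hTw⟩ := ih
    obtain ⟨l, hl⟩ := exists_cell_functional (p := p) hγ0 hh k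
    let e : WLp d γ (2 * p) := indicatorConstLp (ENNReal.ofReal (2 * p))
      (measurableSet_cell h k) (weightedMeasure_cell_ne_top hγ hh k) (1 : ℝ)
    refine ⟨l.smulRight e + T, IsCompactOperator.add ?_ hT, fun w => ?_⟩
    -- The new summand factors through $\mathbb R$, which is locally compact.
    · have h1 : IsCompactOperator (ContinuousLinearMap.toSpanSingleton ℝ e) :=
        isCompactOperator_of_locallyCompactSpace_rng _
      exact h1.comp_clm l
    · have h2 : (l.smulRight e + T) w = l w • e + T w := rfl
      rw [h2]
      filter_upwards [Lp.coeFn_add (l w • e) (T w), Lp.coeFn_smul (l w) e, hTw w,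
        indicatorConstLp_coeFn (p := ENNReal.ofReal (2 * p)) (hs := measurableSet_cell h k)
          (hμs := weightedMeasure_cell_ne_top hγ hh k) (c := (1 : ℝ))] with x h3 h4 h5 h6
      rw [h3, Pi.add_apply, h4, h5, Pi.smul_apply, h6]
      by_cases hx : cellIndex h x = k
      · have hx' : x ∈ cell h k := hx
        simp [hx, hk, hx', cellAverage, hl]
      · have hx' : x ∉ cell h k := hx
        simp [hx, hx']

end HSpace

end CKN

/-! ### Uniform approximation by grid averages -/

namespace CKN

open Filter Set
open scoped Topology NNReal

section Approx

variable {d : ℕ} [hd : Fact (3 ≤ d)] {p γ : ℝ} [hp1 : Fact (1 < p)]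

/-- The exponent $q=p+1$ is admissible in the Sobolev inequality because $2\le p+1\le
2p<2^*_\gamma$; the two norms on the right are each at most 1. -/
theorem exists_lintegral_sobolev_le (hγ0 : 0 < γ) (hp : p * (d - 2) < d - γ) :
    ∃ B : ℝ≥0, ∀ w : HSpace d p γ, ‖w‖ ≤ 1 → ∫⁻ x, ‖fn w x‖ₑ ^ sobolevExp d ≤ B := by
  have hp1 := hp1.out
  have hd' : (3 : ℝ) ≤ d := by exact_mod_cast hd.out
  have hQ : 0 < sobolevExp d := by
    rw [sobolevExp]
    apply div_pos <;> linarith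
  obtain ⟨C, hC⟩ := HasWeakGradient.sobolev hd.out hγ0.le (q := p + 1) (by linarith)
    (by nlinarith)
  refine ⟨((C : ℝ≥0) * (1 + 1)) ^ sobolevExp d, fun w hw => ?_⟩
  have h1 := hC _ _ (hasWeakGradient w) (measurable_fn w) (measurable_grad w)
  have h2 : eLpNorm (fn w) (ENNReal.ofReal (sobolevExp d)) volume ≤ ((C * (1 + 1) : ℝ≥0) : ℝ≥0∞) := by
    refine h1.trans ?_
    push_cast
    gcongr
    · exact (eLpNorm_fn_le w).trans (ENNReal.ofReal_le_one.2 hw)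
    · exact (eLpNorm_grad_le w).trans (ENNReal.ofReal_le_one.2 hw)
  rw [ENNReal.coe_rpow_of_nonneg _ hQ.le]
  exact lintegral_rpow_enorm_le_of_eLpNorm_le hQ h2

theorem exists_pos_lt_of_tendsto {α : Type*} {l : Filter α} [l.NeBot] {P : α → Prop}
    (hP : ∀ᶠ a in l, P a) {f : α → ℝ≥0∞} (hf : Tendsto f l (𝓝 0)) {ε : ℝ≥0∞} (hε : 0 < ε) :
    ∃ a, P a ∧ f a ≤ ε :=
  (hP.and (hf.eventually (ge_mem_nhds hε))).exists

/-- The order of choice matters: $r$ is fixed by the near term, then $h$ is taken small enough to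
beat the factor $r^{-\gamma}$. The far term depends on $R$ alone. -/
theorem exists_radii {d : ℕ} {γ : ℝ} (hd : 3 ≤ d) (hγ0 : 0 < γ) {a t σ : ℝ} {D B' η : ℝ≥0∞}
    {B : ℝ≥0} (hγa : γ / (1 - a) < d) (ha0 : 0 < a) (ha1 : a < 1) (ht0 : 0 < t) (ht1 : t < 1)
    (hσ0 : 0 < σ) (hDt : D ≠ ⊤) (hB't : B' ≠ ⊤) (hη0 : 0 < η) :
    ∃ r h R : ℝ, 0 < r ∧ 0 < h ∧ 0 < R ∧
      B' ^ a * (∫⁻ x : Space d in Metric.ball 0 r,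
        ENNReal.ofReal (‖x‖ ^ (-(γ / (1 - a))))) ^ (1 - a) ≤ η ∧
      ENNReal.ofReal (r ^ (-γ)) *
        ((D * (ENNReal.ofReal ((d + 1) * h) ^ (2 : ℝ) * 1)) ^ (1 - t) * B' ^ t) ≤ η ∧
      (1 : ℝ≥0∞) ^ (1 - σ) * (ENNReal.ofReal (R ^ (-γ)) * B) ^ σ ≤ η := by
  obtain ⟨r, hr, hr1⟩ : ∃ r : ℝ, 0 < r ∧ B' ^ a * (∫⁻ x : Space d in Metric.ball 0 r,
      ENNReal.ofReal (‖x‖ ^ (-(γ / (1 - a))))) ^ (1 - a) ≤ η := by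
    refine exists_pos_lt_of_tendsto (l := 𝓝[>] (0 : ℝ)) self_mem_nhdsWithin ?_ hη0
    have h1 := (ENNReal.continuous_rpow_const (y := 1 - a)).tendsto 0 |>.comp
      (tendsto_setLIntegral_norm_rpow_neg hd hγa)
    rw [ENNReal.zero_rpow_of_pos (by linarith)] at h1
    have h2 := ENNReal.Tendsto.const_mul (a := B' ^ a) h1
      (Or.inr (ENNReal.rpow_ne_top_of_nonneg ha0.le hB't))
    simpa using h2
  obtain ⟨h, hh, hh1⟩ : ∃ h : ℝ, 0 < h ∧ ENNReal.ofReal (r ^ (-γ)) *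
      ((D * (ENNReal.ofReal ((d + 1) * h) ^ (2 : ℝ) * 1)) ^ (1 - t) * B' ^ t) ≤ η := by
    refine exists_pos_lt_of_tendsto (l := 𝓝[>] (0 : ℝ)) self_mem_nhdsWithin ?_ hη0
    have h1 : Tendsto (fun h : ℝ => ENNReal.ofReal ((d + 1) * h) ^ (2 : ℝ)) (𝓝[>] 0) (𝓝 0) := by
      have hc : Continuous fun h : ℝ => ENNReal.ofReal ((d + 1) * h) ^ (2 : ℝ) :=
        ENNReal.continuous_rpow_const.comp (ENNReal.continuous_ofReal.comp (by fun_prop))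
      simpa using (hc.tendsto 0).mono_left (nhdsWithin_le_nhds (s := Ioi 0))
    have h2 := ENNReal.Tendsto.const_mul (a := D) h1 (Or.inr hDt)
    rw [mul_zero] at h2
    have h3 := (ENNReal.continuous_rpow_const (y := 1 - t)).tendsto 0 |>.comp h2
    rw [ENNReal.zero_rpow_of_pos (by linarith)] at h3
    have h4 := ENNReal.Tendsto.mul_const (b := B' ^ t) h3
      (Or.inr (ENNReal.rpow_ne_top_of_nonneg ht0.le hB't))
    rw [zero_mul] at h4
    have h5 := ENNReal.Tendsto.const_mul (a := ENNReal.ofReal (r ^ (-γ))) h4 (Or.inr (by simp))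
    simpa using h5
  obtain ⟨R, hR, hR1⟩ : ∃ R : ℝ, 0 < R ∧
      (1 : ℝ≥0∞) ^ (1 - σ) * (ENNReal.ofReal (R ^ (-γ)) * B) ^ σ ≤ η := by
    refine exists_pos_lt_of_tendsto (l := atTop) (eventually_gt_atTop 0) ?_ hη0
    have h1 : Tendsto (fun R : ℝ => ENNReal.ofReal (R ^ (-γ))) atTop (𝓝 0) := by
      have := ENNReal.tendsto_ofReal (tendsto_rpow_neg_atTop hγ0)
      simpa using this
    have h2 := ENNReal.Tendsto.mul_const (b := (B : ℝ≥0∞)) h1 (Or.inr (by simp))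
    rw [zero_mul] at h2
    have h3 := (ENNReal.continuous_rpow_const (y := σ)).tendsto 0 |>.comp h2
    rw [ENNReal.zero_rpow_of_pos hσ0] at h3
    simpa [Function.comp_def] using h3
  exact ⟨r, h, R, hr, hh, hR, hr1, hh1, hR1⟩

theorem exists_third {e : ℝ≥0∞} (he : 0 < e) : ∃ η : ℝ≥0∞, 0 < η ∧ η + η + η = e := by
  refine ⟨e / 3, ENNReal.div_pos he.ne' (by simp), ?_⟩
  exact ENNReal.add_thirds e

/-- Averages over the cells of a grid approximate functions with bounded norms uniformly
in `L^{2p}_γ`. -/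
theorem exists_grid_approx {d : ℕ} {p γ : ℝ} (hd : 3 ≤ d) (hp1 : 1 < p) (hγ0 : 0 < γ)
    (hp : p * (d - 2) < d - γ) (B : ℝ≥0) {ε : ℝ} (hε : 0 < ε) :
    ∃ (h : ℝ) (s : Finset (Fin d → ℤ)), 0 < h ∧
      ∀ (w : Space d → ℝ) (g : Space d → Space d), HasWeakGradient w g → Measurable w →
        Measurable g → ∫⁻ x, ‖w x‖ₑ ^ sobolevExp d ≤ B →
        eLpNorm w (ENNReal.ofReal (p + 1)) (weightedMeasure d γ) ≤ 1 → eLpNorm g 2 volume ≤ 1 →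
        eLpNorm (fun x => w x - if cellIndex h x ∈ s then cellAverage h w x else 0)
          (ENNReal.ofReal (2 * p)) (weightedMeasure d γ) ≤ ENNReal.ofReal ε := by
  have hd' : (3 : ℝ) ≤ d := by exact_mod_cast hd
  have hγd : γ < d := by nlinarith
  have hQ2 : 2 * p < sobolevExp d := by
    rw [sobolevExp, lt_div_iff₀ (by linarith)]
    linarith
  have hQ : 0 < sobolevExp d := by linarith
  have hDt : ballCellRatio d ≠ ⊤ := ballCellRatio_ne_top d
  -- A bound for the $2^*$ integral of the error, from $(x+y)^Q\le2^{Q-1}(x^Q+y^Q)$ and the $L^Q$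
  -- bound for cell averages.
  obtain ⟨B', hB'⟩ : ∃ B' : ℝ≥0∞, B' = (2 : ℝ≥0∞) ^ (sobolevExp d - 1) * (B + ballCellRatio d * B) :=
    ⟨_, rfl⟩
  have hB't : B' ≠ ⊤ := by
    rw [hB']
    refine ENNReal.mul_ne_top (ENNReal.rpow_ne_top_of_nonneg (by linarith) (by simp)) ?_
    exact ENNReal.add_ne_top.2 ⟨by simp, ENNReal.mul_ne_top hDt (by simp)⟩
  obtain ⟨a, ha⟩ : ∃ a : ℝ, a = p * (d - 2) / d := ⟨_, rfl⟩
  have ha0 : 0 < a := ha ▸ div_pos (mul_pos (by linarith) (by linarith)) (by linarith)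
  have ha1 : a < 1 := by rw [ha, div_lt_one (by linarith)]; linarith
  obtain ⟨t, ht⟩ : ∃ t : ℝ, t = (2 * p - 2) / (sobolevExp d - 2) := ⟨_, rfl⟩
  have ht0 : 0 < t := ht ▸ div_pos (by linarith) (by linarith)
  have ht1 : t < 1 := by rw [ht, div_lt_one (by linarith)]; linarith
  obtain ⟨σ, hσ⟩ : ∃ σ : ℝ, σ = (2 * p - (p + 1)) / (sobolevExp d - (p + 1)) := ⟨_, rfl⟩
  have hσ0 : 0 < σ := hσ ▸ div_pos (by linarith) (by linarith)
  have hσ1 : σ < 1 := by rw [hσ, div_lt_one (by linarith)]; linarith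
  -- Since $d(1-a)=d-p(d-2)$, this is the subcriticality assumption.
  have hγa : γ / (1 - a) < d := by
    rw [div_lt_iff₀ (by linarith), ha]
    have : (d : ℝ) * (1 - p * (d - 2) / d) = d - p * (d - 2) := by field_simp
    rw [this]
    linarith
  obtain ⟨η, hη0, hη3⟩ := exists_third (ENNReal.rpow_pos (p := 2 * p)
    (ENNReal.ofReal_pos.2 hε) ENNReal.ofReal_ne_top)
  obtain ⟨r, h, R, hr, hh, hR, hr1, hh1, hR1⟩ := exists_radii (B := B) hd hγ0 hγa ha0 ha1 ht0
    ht1 hσ0 hDt hB't hη0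
  obtain ⟨s, hs⟩ := exists_finset_cellIndex d hh R
  refine ⟨h, s, hh, fun w g hwg hwm hgm hBw hwp1 hg2 => ?_⟩
  set S : Set (Space d) := {x | cellIndex h x ∈ s} with hS
  have hSm : MeasurableSet S := measurable_cellIndex h s.measurableSet
  have havm : Measurable (cellAverage h w) := by
    have h1 : Measurable fun k : Fin d → ℤ => (h ^ d)⁻¹ * ∫ y in cell h k, w y :=
      measurable_of_countable _
    exact h1.comp (measurable_cellIndex h)
  set v : Space d → ℝ := fun x => if cellIndex h x ∈ s then cellAverage h w x else 0 with hv
  have hvm : Measurable v := Measurable.ite hSm havm measurable_const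
  set u : Space d → ℝ := fun x => w x - v x with hu
  have hum : Measurable u := hwm.sub hvm
  refine eLpNorm_le_of_lintegral_rpow_enorm_le (by linarith) ?_
  have huQ : ∫⁻ x, ‖u x‖ₑ ^ sobolevExp d ≤ B' := by
    calc _ ≤ ∫⁻ x, 2 ^ (sobolevExp d - 1) * (‖w x‖ₑ ^ sobolevExp d + ‖cellAverage h w x‖ₑ ^ sobolevExp d) := by
          refine lintegral_mono fun x => ?_
          have h1 : ‖u x‖ₑ ≤ ‖w x‖ₑ + ‖cellAverage h w x‖ₑ := by
            refine (enorm_sub_le).trans ?_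
            gcongr
            by_cases hx : cellIndex h x ∈ s <;> simp [hv, hx]
          exact (ENNReal.rpow_le_rpow h1 hQ.le).trans
            (ENNReal.rpow_add_le_mul_rpow_add_rpow _ _ (by linarith))
      _ = 2 ^ (sobolevExp d - 1) * ((∫⁻ x, ‖w x‖ₑ ^ sobolevExp d) + ∫⁻ x, ‖cellAverage h w x‖ₑ ^ sobolevExp d) := by
          rw [lintegral_const_mul' _ _ (ENNReal.rpow_ne_top_of_nonneg (by linarith) (by simp)),
            lintegral_add_left (hwm.enorm.pow_const _)]
      _ ≤ B' := by
          rw [hB']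
          refine mul_le_mul_right (add_le_add hBw ?_) _
          exact (lintegral_cellAverage_le hh hwm (by linarith)).trans (mul_le_mul_right hBw _)
  have hu2 : ∫⁻ x in S, ‖u x‖ₑ ^ (2 : ℝ) ≤ ballCellRatio d * (ENNReal.ofReal ((d + 1) * h) ^ (2 : ℝ) * 1) := by
    calc _ = ∫⁻ x in S, ‖w x - cellAverage h w x‖ₑ ^ (2 : ℝ) := by
          refine setLIntegral_congr_fun hSm fun x hx => ?_
          have hx' : cellIndex h x ∈ s := hx
          simp only [hu, hv, hx', if_true]
      _ ≤ ∫⁻ x, ‖w x - cellAverage h w x‖ₑ ^ (2 : ℝ) := setLIntegral_le_lintegral _ _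
      _ ≤ _ := hwg.lintegral_sub_cellAverage_le hh hwm hgm
      _ ≤ _ := by
          refine mul_le_mul_right (mul_le_mul_right ?_ _) _
          have hg2' : eLpNorm g (ENNReal.ofReal 2) volume ≤ 1 := by simpa using hg2
          simpa using lintegral_rpow_enorm_le_of_eLpNorm_le (by norm_num) hg2'
  have hwp : ∫⁻ x, ‖w x‖ₑ ^ (p + 1) ∂(weightedMeasure d γ) ≤ 1 := by
    simpa using lintegral_rpow_enorm_le_of_eLpNorm_le (by linarith) hwp1
  have hoff : ∀ x, x ∉ S → u x = w x := by
    intro x hx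
    have hx' : cellIndex h x ∉ s := hx
    simp [hu, hv, hx']
  have hmain := lintegral_weightedMeasure_le hd hγ0 hp1 hp hum hwm hSm hr hR hs hoff
  rw [← ha, ← ht, ← hσ] at hmain
  refine hmain.trans ?_
  rw [← hη3]
  refine add_le_add (add_le_add (le_trans ?_ hr1) (le_trans ?_ hh1)) (le_trans ?_ hR1)
  · gcongr
  · refine mul_le_mul_right (mul_le_mul' (ENNReal.rpow_le_rpow hu2 (by linarith))
      (ENNReal.rpow_le_rpow huQ ht0.le)) _
  · exact mul_le_mul' (ENNReal.rpow_le_rpow hwp (by linarith))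
      (ENNReal.rpow_le_rpow (mul_le_mul_right hBw _) hσ0.le)

/-- The elements of `H_{p,γ}` are approximated in `L^{2p}_γ` by finite rank operators, uniformly
on the unit ball. -/
theorem exists_compact_approx (hγ0 : 0 < γ) (hp : p * (d - 2) < d - γ) {ε : ℝ} (hε : 0 < ε) :
    ∃ T : HSpace d p γ →L[ℝ] WLp d γ (2 * p), IsCompactOperator T ∧
      ∀ w : HSpace d p γ, ‖w‖ ≤ 1 →
        eLpNorm (fn w - (T w : Space d → ℝ)) (ENNReal.ofReal (2 * p)) (weightedMeasure d γ)
          ≤ ENNReal.ofReal ε := by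
  have hγd : γ < d := by
    have hp1 := hp1.out
    have hd' : (3 : ℝ) ≤ d := by exact_mod_cast hd.out
    nlinarith
  obtain ⟨B, hB⟩ := exists_lintegral_sobolev_le (p := p) hγ0 hp
  obtain ⟨h, s, hh, happ⟩ := exists_grid_approx hd.out hp1.out hγ0 hp B hε
  obtain ⟨T, hT, hTw⟩ := exists_finiteRank (p := p) hγ0 hγd hh s
  refine ⟨T, hT, fun w hw => ?_⟩
  rw [eLpNorm_congr_ae (EventuallyEq.rfl.sub (hTw w))]
  exact happ _ _ (hasWeakGradient w) (measurable_fn w) (measurable_grad w) (hB w hw)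
    ((eLpNorm_fn_le w).trans (ENNReal.ofReal_le_one.2 hw))
    ((eLpNorm_grad_le w).trans (ENNReal.ofReal_le_one.2 hw))

end Approx

end CKN

/-! ### The compact embedding -/

namespace CKN

open Filter Set
open scoped Topology NNReal

section Embedding

variable {d : ℕ} [hd : Fact (3 ≤ d)] {p γ : ℝ} [hp1 : Fact (1 < p)]

/-- On the unit ball both `T v` and the error are in $L^{2p}_\gamma$. Dividing by $\|w\|+1$ rather
than $\|w\|$ reduces every $w$ to this case, including $w=0$. -/
theorem memLp_fn (hγ0 : 0 < γ) (hp : p * (d - 2) < d - γ) (w : HSpace d p γ) :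
    MemLp (fn w) (ENNReal.ofReal (2 * p)) (weightedMeasure d γ) := by
  obtain ⟨T, -, hT⟩ := exists_compact_approx (p := p) hγ0 hp one_pos
  have hunit : ∀ v : HSpace d p γ, ‖v‖ ≤ 1 →
      MemLp (fn v) (ENNReal.ofReal (2 * p)) (weightedMeasure d γ) := by
    intro v hv
    have h1 : MemLp (fn v - (T v : Space d → ℝ)) (ENNReal.ofReal (2 * p)) (weightedMeasure d γ) :=
      ⟨(measurable_fn v).aestronglyMeasurable.sub (Lp.aestronglyMeasurable _),
        (hT v hv).trans_lt ENNReal.ofReal_lt_top⟩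
    simpa using h1.add (Lp.memLp (T v))
  have hc : 0 < ‖w‖ + 1 := by positivity
  have h1 := hunit ((‖w‖ + 1)⁻¹ • w) (by
    rw [norm_smul, norm_inv, Real.norm_of_nonneg hc.le, inv_mul_le_one₀ hc]
    linarith)
  refine (h1.const_smul (‖w‖ + 1)).ae_eq ?_
  filter_upwards [fn_smul (‖w‖ + 1)⁻¹ w] with x hx
  rw [Pi.smul_apply, hx, Pi.smul_apply, smul_inv_smul₀ hc.ne']

theorem norm_le_of_unit_bound {E F : Type*} [NormedAddCommGroup E] [NormedSpace ℝ E]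
    [NormedAddCommGroup F] [NormedSpace ℝ F] (f : E →ₗ[ℝ] F) {C : ℝ}
    (h : ∀ x, ‖x‖ ≤ 1 → ‖f x‖ ≤ C) (x : E) : ‖f x‖ ≤ C * ‖x‖ := by
  rcases eq_or_ne x 0 with rfl | hx
  · simp
  have hx' : 0 < ‖x‖ := norm_pos_iff.2 hx
  have h1 := h (‖x‖⁻¹ • x) (by rw [norm_smul, norm_inv, norm_norm, inv_mul_cancel₀ hx'.ne'])
  rw [map_smul, norm_smul, norm_inv, norm_norm, inv_mul_le_iff₀ hx'] at h1
  linarith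

/-- The inclusion of `H_{p,γ}` into `L^{2p}_γ` as a linear map. -/
noncomputable def inclusion (hγ0 : 0 < γ) (hp : p * (d - 2) < d - γ) :
    HSpace d p γ →ₗ[ℝ] WLp d γ (2 * p) where
  toFun w := (memLp_fn hγ0 hp w).toLp (fn w)
  map_add' v w := by
    rw [← MemLp.toLp_add]
    exact MemLp.toLp_congr _ _ (fn_add v w)
  map_smul' c w := by
    rw [RingHom.id_apply, ← MemLp.toLp_const_smul]
    exact MemLp.toLp_congr _ _ (fn_smul c w)

theorem coeFn_inclusion (hγ0 : 0 < γ) (hp : p * (d - 2) < d - γ) (w : HSpace d p γ) :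
    inclusion hγ0 hp w =ᵐ[weightedMeasure d γ] fn w :=
  MemLp.coeFn_toLp (memLp_fn hγ0 hp w)

theorem norm_inclusion_sub_le (hγ0 : 0 < γ) (hp : p * (d - 2) < d - γ) {ε : ℝ} (hε : 0 < ε) :
    ∃ T : HSpace d p γ →L[ℝ] WLp d γ (2 * p), IsCompactOperator T ∧
      ∀ w : HSpace d p γ, ‖w‖ ≤ 1 → ‖inclusion hγ0 hp w - T w‖ ≤ ε := by
  obtain ⟨T, hT, hTw⟩ := exists_compact_approx (p := p) hγ0 hp hε
  refine ⟨T, hT, fun w hw => ?_⟩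
  rw [Lp.norm_def]
  refine ENNReal.toReal_le_of_le_ofReal hε.le ?_
  refine (eLpNorm_congr_ae ?_).trans_le (hTw w hw)
  filter_upwards [Lp.coeFn_sub (inclusion hγ0 hp w) (T w), coeFn_inclusion hγ0 hp w] with x h1 h2
  rw [h1, Pi.sub_apply, Pi.sub_apply, h2]

theorem exists_bound_inclusion (hγ0 : 0 < γ) (hp : p * (d - 2) < d - γ) :
    ∃ C : ℝ, ∀ w : HSpace d p γ, ‖inclusion hγ0 hp w‖ ≤ C * ‖w‖ := by
  obtain ⟨T, -, hT⟩ := norm_inclusion_sub_le (p := p) hγ0 hp one_pos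
  refine ⟨1 + ‖T‖, norm_le_of_unit_bound _ fun w hw => ?_⟩
  calc ‖inclusion hγ0 hp w‖ = ‖(inclusion hγ0 hp w - T w) + T w‖ := by rw [sub_add_cancel]
    _ ≤ ‖inclusion hγ0 hp w - T w‖ + ‖T w‖ := norm_add_le _ _
    _ ≤ 1 + ‖T‖ := add_le_add (hT w hw) ((T.le_opNorm w).trans
        (mul_le_of_le_one_right T.opNorm_nonneg hw))

/-- The inclusion of `H_{p,γ}` into `L^{2p}_γ`. -/
noncomputable def embedding (hγ0 : 0 < γ) (hp : p * (d - 2) < d - γ) : HSpace d p γ →L[ℝ] WLp d γ (2 * p) :=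
  (inclusion hγ0 hp).mkContinuousOfExistsBound (exists_bound_inclusion hγ0 hp)

theorem coeFn_embedding (hγ0 : 0 < γ) (hp : p * (d - 2) < d - γ) (w : HSpace d p γ) :
    embedding hγ0 hp w =ᵐ[weightedMeasure d γ] fn w :=
  coeFn_inclusion hγ0 hp w

/-- Compact operators are closed in operator norm, and the averaging operators come arbitrarily
close to the embedding. -/
theorem isCompactOperator_embedding (hγ0 : 0 < γ) (hp : p * (d - 2) < d - γ) :
    IsCompactOperator (embedding hγ0 hp : HSpace d p γ →L[ℝ] WLp d γ (2 * p)) := by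
  have hcl := isClosed_setOfPred_isCompactOperator (σ₁₂ := RingHom.id ℝ)
    (M₁ := HSpace d p γ) (M₂ := WLp d γ (2 * p))
  refine hcl.closure_subset ((Metric.mem_closure_iff
    (α := HSpace d p γ →L[ℝ] WLp d γ (2 * p))).2 fun ε hε => ?_)
  obtain ⟨T, hT, hTw⟩ := norm_inclusion_sub_le (p := p) hγ0 hp (half_pos hε)
  refine ⟨T, hT, ?_⟩
  refine lt_of_le_of_lt (le_trans (le_of_eq (dist_eq_norm (embedding hγ0 hp) T)) ?_)
    (half_lt_self hε)
  exact ContinuousLinearMap.opNorm_le_of_unit_norm (half_pos hε).le fun w hw => hTw w hw.le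

/-- Elements of `HSpace` are pairs, so injectivity of the embedding requires that the function
determine its gradient. This follows coordinatewise from the fundamental lemma of the calculus of
variations. -/
theorem HasWeakGradient.ae_eq_zero {d : ℕ} {g : Space d → Space d}
    {w : Space d → ℝ} (h : HasWeakGradient w g) (hw : w =ᵐ[volume] 0) : g =ᵐ[volume] 0 := by
  have h1 : ∀ v : Space d, ∀ᵐ x, inner ℝ (g x) v = 0 := by
    intro v
    refine ae_eq_zero_of_integral_contDiff_smul_eq_zero (fun x => ?_) fun φ hφ hφc => ?_
    · obtain ⟨s, hs, hs'⟩ := h.locInt_grad x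
      exact ⟨s, hs, hs'.inner_const v⟩
    · have h2 := h.integral_eq φ hφ hφc v
      have h3 : ∫ x, w x * fderiv ℝ φ x v = 0 := by
        refine integral_eq_zero_of_ae ?_
        filter_upwards [hw] with x hx
        simp [hx]
      rw [h3, zero_eq_neg] at h2
      simpa [mul_comm] using h2
  have h2 : ∀ᵐ x, ∀ i : Fin d, inner ℝ (g x) (EuclideanSpace.single i (1 : ℝ)) = 0 :=
    ae_all_iff.2 fun i => h1 _
  filter_upwards [h2] with x hx
  ext i
  have := hx i
  rw [EuclideanSpace.inner_single_right] at this
  simpa using this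

theorem eq_zero_of_fn_ae_eq_zero {w : HSpace d p γ} (h : fn w =ᵐ[volume] 0) : w = 0 := by
  have h1 : w.1.fst = 0 := by
    rw [Lp.eq_zero_iff_ae_eq_zero]
    exact (weightedMeasure_absolutelyContinuous d γ).ae_le h
  have h2 : w.1.snd = 0 := by
    rw [Lp.eq_zero_iff_ae_eq_zero]
    exact (hasWeakGradient w).ae_eq_zero h
  rw [← norm_eq_zero, norm_eq_add, h1, h2]
  simp

theorem embedding_injective (hγ0 : 0 < γ) (hp : p * (d - 2) < d - γ) :
    Function.Injective (embedding hγ0 hp : HSpace d p γ →L[ℝ] WLp d γ (2 * p)) := by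
  rw [injective_iff_map_eq_zero]
  intro w hw
  refine eq_zero_of_fn_ae_eq_zero (ae_volume_of_ae_weightedMeasure (γ := γ) ?_)
  filter_upwards [coeFn_embedding hγ0 hp w,
    (Lp.eq_zero_iff_ae_eq_zero (f := embedding hγ0 hp w)).1 hw] with x h1 h2
  rw [← h1, h2]

end Embedding

end CKN

/-! ### Weak limits, construction of elements and bounds from the energy -/

namespace CKN

open Filter Set
open scoped Topology NNReal

/-- Weak compactness of bounded sets in Hilbert spaces, along an ultrafilter. -/
theorem exists_weak_limit {H : Type*} [NormedAddCommGroup H] [InnerProductSpace ℝ H]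
    [CompleteSpace H] (U : Ultrafilter ℕ) (x : ℕ → H) {a : ℝ} (hx : ∀ n, ‖x n‖ ≤ a)
    {b : ℝ} (hb : Tendsto (fun n => ‖x n‖) U (𝓝 b)) :
    ∃ g : H, ‖g‖ ≤ b ∧ ∀ h, Tendsto (fun n => inner ℝ (x n) h) U (𝓝 (inner ℝ g h)) := by
  have hlim : ∀ h : H, ∃ l : ℝ, Tendsto (fun n => inner ℝ (x n) h) U (𝓝 l) := by
    intro h
    obtain ⟨l, -, hl⟩ := (isCompact_Icc (a := -(a * ‖h‖)) (b := a * ‖h‖)).ultrafilter_le_nhds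
      (U.map fun n => inner ℝ (x n) h) (by
        rw [le_principal_iff]
        refine Filter.mem_map.2 (univ_mem' fun n => ?_)
        have h1 := abs_real_inner_le_norm (x n) h
        have h2 : ‖x n‖ * ‖h‖ ≤ a * ‖h‖ := by gcongr; exact hx n
        exact abs_le.1 (h1.trans h2))
    exact ⟨l, hl⟩
  choose L hL using hlim
  -- Using the limit $b$ of the norms, not the uniform bound $a$, gives weak lower semicontinuity of
  -- the norm; the functional is then represented by Riesz' theorem.
  have hLb : ∀ h, |L h| ≤ b * ‖h‖ := fun h =>
    le_of_tendsto_of_tendsto (hL h).abs (hb.mul_const ‖h‖)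
      (Eventually.of_forall fun n => abs_real_inner_le_norm (x n) h)
  let Ll : H →ₗ[ℝ] ℝ :=
    { toFun := L
      map_add' := fun u v => tendsto_nhds_unique (hL (u + v)) (by
        simpa only [inner_add_right] using (hL u).add (hL v))
      map_smul' := fun c u => tendsto_nhds_unique (hL (c • u)) (by
        have h1 := (hL u).const_mul c
        simp only [inner_smul_right]
        exact h1) }
  have hb0 : 0 ≤ b := ge_of_tendsto hb (Eventually.of_forall fun n => norm_nonneg _)
  refine ⟨(InnerProductSpace.toDual ℝ H).symm (Ll.mkContinuous b hLb), ?_, fun h => ?_⟩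
  · rw [LinearIsometryEquiv.norm_map]
    exact LinearMap.mkContinuous_norm_le _ hb0 _
  · rw [InnerProductSpace.toDual_symm_apply]
    exact hL h

section Minimizer

variable {d : ℕ} [hd : Fact (3 ≤ d)] {p γ : ℝ} [hp1 : Fact (1 < p)]

theorem locallyIntegrable_of_memLp {d : ℕ} {γ : ℝ} (hd : 3 ≤ d) (hγ0 : 0 ≤ γ) {q : ℝ} (hq : 1 ≤ q)
    {w : Space d → ℝ} (hwm : AEStronglyMeasurable w volume)
    (hw : MemLp w (ENNReal.ofReal q) (weightedMeasure d γ)) : LocallyIntegrable w volume := by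
  intro x
  obtain ⟨C, hC⟩ := exists_setLIntegral_ball_le hd hγ0 hq (by positivity : 0 < ‖x‖ + 1)
  refine ⟨Metric.ball 0 (‖x‖ + 1), Metric.isOpen_ball.mem_nhds (by simp), hwm.restrict, ?_⟩
  exact (hC w hwm).trans_lt (ENNReal.mul_lt_top (by simp) hw.2)

/-- Construction of elements of `H_{p,γ}`. -/
theorem exists_HSpace (hγ0 : 0 ≤ γ) {w : Space d → ℝ} {g : Space d → Space d}
    (hwm : AEStronglyMeasurable w volume)
    (hw : MemLp w (ENNReal.ofReal (p + 1)) (weightedMeasure d γ)) (hg : MemLp g 2 volume)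
    (h : ∀ φ : Space d → ℝ, ContDiff ℝ ∞ φ → HasCompactSupport φ → ∀ v : Space d,
      ∫ x, w x * fderiv ℝ φ x v = -∫ x, inner ℝ (g x) v * φ x) :
    ∃ u : HSpace d p γ, fn u =ᵐ[volume] w ∧ grad u =ᵐ[volume] g := by
  have hp := hp1.out
  have hwg : HasWeakGradient w g :=
    ⟨locallyIntegrable_of_memLp hd.out hγ0 (by linarith) hwm hw,
      hg.locallyIntegrable (by norm_num), h⟩
  have h1 : (hw.toLp w : Space d → ℝ) =ᵐ[volume] w :=
    ae_volume_of_ae_weightedMeasure (γ := γ) hw.coeFn_toLp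
  exact ⟨⟨WithLp.toLp 1 (hw.toLp w, hg.toLp g), hwg.congr h1 hg.coeFn_toLp⟩, h1, hg.coeFn_toLp⟩

theorem G_eq (w : HSpace d p γ) :
    G w = 1 / 2 * ‖w.1.snd‖ ^ 2 + 1 / (p + 1) * ‖w.1.fst‖ ^ (p + 1) := by
  have hp := hp1.out
  have h1 : ‖w.1.fst‖ = wnorm (p + 1) γ (fn w) := norm_WLp_eq (by linarith) _
  -- The two formulas for the norm share their first summand, so cancelling it identifies the
  -- gradient norms.
  have h2 := norm_HSpace_eq w
  rw [norm_eq_add, h1] at h2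
  rw [G, h1, add_left_cancel h2]

theorem mass_eq (hγ0 : 0 < γ) (hp : p * (d - 2) < d - γ) (w : HSpace d p γ) :
    mass w = ‖embedding hγ0 hp w‖ ^ (2 * p) := by
  have hp1 := hp1.out
  rw [norm_WLp_eq (by linarith), mass, wnorm, wnorm]
  congr 2
  refine integral_congr_ae ?_
  filter_upwards [ae_volume_of_ae_weightedMeasure (coeFn_embedding hγ0 hp w)] with x hx
  rw [hx]

theorem le_max_one_of_rpow_le {t A q : ℝ} (hq : 1 ≤ q) (h : t ^ q ≤ A) : t ≤ max 1 A := by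
  rcases le_or_gt t 1 with h1 | h1
  · exact h1.trans (le_max_left _ _)
  · exact ((Real.self_le_rpow_of_one_le h1.le hq).trans h).trans (le_max_right _ _)

theorem exists_bound_of_G_le (p : ℝ) [hp1 : Fact (1 < p)] (C : ℝ) : ∃ K : ℝ, ∀ w : HSpace d p γ,
    G w ≤ C → ‖w.1.fst‖ ≤ K ∧ ‖w.1.snd‖ ≤ K := by
  have hp := hp1.out
  refine ⟨max (max 1 ((p + 1) * C)) (max 1 (2 * C)), fun w hw => ?_⟩
  rw [G_eq] at hw
  have h1 : 0 ≤ 1 / 2 * ‖w.1.snd‖ ^ 2 := by positivity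
  have h2 : 0 ≤ 1 / (p + 1) * ‖w.1.fst‖ ^ (p + 1) := by positivity
  constructor
  · refine (le_max_one_of_rpow_le (q := p + 1) (by linarith) ?_).trans (le_max_left _ _)
    have h3 : 1 / (p + 1) * ‖w.1.fst‖ ^ (p + 1) ≤ C := by linarith
    rwa [one_div, inv_mul_le_iff₀ (by linarith)] at h3
  · refine (le_max_one_of_rpow_le (q := 2) (by norm_num) ?_).trans (le_max_right _ _)
    rw [Real.rpow_two]
    linarith

/-- Pairing with a continuous compactly supported function is continuous on `L^q_γ`. -/
theorem tendsto_integral_mul {d : ℕ} {γ : ℝ} (hd : 3 ≤ d) (hγ0 : 0 < γ) {q : ℝ} (hq : 1 ≤ q)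
    [Fact (1 ≤ ENNReal.ofReal q)]
    {f : ℕ → WLp d γ q} {f₀ : WLp d γ q} (hf : Tendsto f atTop (𝓝 f₀)) {ψ : Space d → ℝ}
    (hψ : Continuous ψ) (hψc : HasCompactSupport ψ) :
    Tendsto (fun n => ∫ x, f n x * ψ x) atTop (𝓝 (∫ x, f₀ x * ψ x)) := by
  have : Fact (3 ≤ d) := ⟨hd⟩
  have hm : ∀ f : WLp d γ q, Measurable (f : Space d → ℝ) := fun f =>
    (Lp.stronglyMeasurable f).measurable
  have hint : ∀ f : WLp d γ q, Integrable fun x => f x * ψ x := by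
    intro f
    have h1 := (locallyIntegrable_of_memLp hd hγ0.le hq (hm f).aestronglyMeasurable
      (Lp.memLp f)).integrable_smul_right_of_hasCompactSupport hψ hψc
    simpa [smul_eq_mul] using h1
  obtain ⟨K, hK⟩ := hψc.exists_bound_of_continuous hψ
  have hK0 : 0 ≤ K := (norm_nonneg _).trans (hK 0)
  obtain ⟨ρ, hρ⟩ := hψc.isCompact.isBounded.subset_ball (0 : Space d)
  have hρ' : tsupport ψ ⊆ Metric.ball 0 (max ρ 1) :=
    hρ.trans (Metric.ball_subset_ball (le_max_left _ _))
  obtain ⟨C, hC⟩ := exists_setLIntegral_ball_le hd hγ0.le hq (by positivity : 0 < max ρ 1)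
  have hbound : ∀ n, ‖(∫ x, f n x * ψ x) - ∫ x, f₀ x * ψ x‖ ≤ K * C * ‖f n - f₀‖ := by
    intro n
    rw [← integral_sub (hint _) (hint _)]
    have h1 : ‖∫ x, (f n x * ψ x - f₀ x * ψ x)‖ₑ ≤ ENNReal.ofReal K * (C * ‖f n - f₀‖ₑ) := by
      calc _ ≤ ∫⁻ x, ‖f n x * ψ x - f₀ x * ψ x‖ₑ := enorm_integral_le_lintegral_enorm _
        _ ≤ ∫⁻ x, (Metric.ball (0 : Space d) (max ρ 1)).indicator
              (fun x => ENNReal.ofReal K * ‖(f n - f₀ : WLp d γ q) x‖ₑ) x := by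
            refine lintegral_mono_ae ?_
            filter_upwards [ae_volume_of_ae_weightedMeasure (Lp.coeFn_sub (f n) f₀)] with x hx
            by_cases hxb : x ∈ Metric.ball (0 : Space d) (max ρ 1)
            · rw [indicator_of_mem hxb, hx, ← sub_mul, Pi.sub_apply, enorm_mul, mul_comm]
              gcongr
              rw [← ofReal_norm]
              exact ENNReal.ofReal_le_ofReal (hK x)
            · have : ψ x = 0 := image_eq_zero_of_notMem_tsupport fun h => hxb (hρ' h)
              simp [this]
        _ = ENNReal.ofReal K * ∫⁻ x in Metric.ball (0 : Space d) (max ρ 1),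
              ‖(f n - f₀ : WLp d γ q) x‖ₑ := by
            rw [lintegral_indicator measurableSet_ball, lintegral_const_mul' _ _ (by simp)]
        _ ≤ _ := by
            gcongr
            rw [Lp.enorm_def]
            exact hC _ (hm _).aestronglyMeasurable
    rw [← ofReal_norm, ← ofReal_norm, ← ENNReal.ofReal_coe_nnreal,
      ← ENNReal.ofReal_mul (by positivity), ← ENNReal.ofReal_mul hK0, ← mul_assoc] at h1
    exact (ENNReal.ofReal_le_ofReal_iff (by positivity)).1 h1
  rw [tendsto_iff_norm_sub_tendsto_zero]
  refine squeeze_zero (fun n => norm_nonneg _) hbound ?_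
  simpa using (tendsto_iff_norm_sub_tendsto_zero.1 hf).const_mul (K * C)

end Minimizer

end CKN

/-! ### Scaling -/

namespace CKN

open Filter Set
open scoped Topology NNReal

section Scaling

theorem memLp_weightedMeasure_iff {d : ℕ} {γ q : ℝ} (hq : 0 < q) {F : Type*}
    [NormedAddCommGroup F] {f : Space d → F} (hf : AEStronglyMeasurable f volume) :
    MemLp f (ENNReal.ofReal q) (weightedMeasure d γ)
      ↔ Integrable (fun x => ‖f x‖ ^ q * ‖x‖ ^ (-γ)) volume := by
  rw [← integrable_norm_rpow_iff (hf.mono_ac (weightedMeasure_absolutelyContinuous d γ))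
    (by simpa using hq) (by simp), ENNReal.toReal_ofReal hq.le, weightedMeasure,
    integrable_withDensity_iff_integrable_smul' (by fun_prop) (by simp)]
  refine integrable_congr (Eventually.of_forall fun x => ?_)
  simp only [smul_eq_mul]
  rw [ENNReal.toReal_ofReal (by positivity), mul_comm]

theorem scaled_integrand {d : ℕ} {γ q : ℝ} {F : Type*} [NormedAddCommGroup F] [NormedSpace ℝ F]
    (f : Space d → F) {a l : ℝ} (ha : 0 < a) (hl : 0 < l) (x : Space d) :
    ‖a • f (l • x)‖ ^ q * ‖x‖ ^ (-γ)
      = a ^ q * l ^ γ * (‖f (l • x)‖ ^ q * ‖l • x‖ ^ (-γ)) := by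
  rw [norm_smul, norm_smul, Real.norm_of_nonneg ha.le, Real.norm_of_nonneg hl.le,
    Real.mul_rpow ha.le (norm_nonneg _), Real.mul_rpow hl.le (norm_nonneg _)]
  have : l ^ γ * l ^ (-γ) = 1 := by rw [← Real.rpow_add hl]; simp
  calc _ = a ^ q * ‖f (l • x)‖ ^ q * ‖x‖ ^ (-γ) * 1 := by ring
    _ = _ := by rw [← this]; ring

theorem wnorm_rpow {d : ℕ} {γ q : ℝ} (hq : 0 < q) {F : Type*} [NormedAddCommGroup F]
    (f : Space d → F) : wnorm q γ f ^ q = ∫ x, ‖f x‖ ^ q * ‖x‖ ^ (-γ) := by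
  rw [wnorm, ← Real.rpow_mul (integral_nonneg fun x => by positivity), one_div,
    inv_mul_cancel₀ hq.ne', Real.rpow_one]

theorem wnorm_congr {d : ℕ} {γ q : ℝ} {F : Type*} [NormedAddCommGroup F]
    {f g : Space d → F} (h : f =ᵐ[volume] g) : wnorm q γ f = wnorm q γ g := by
  rw [wnorm, wnorm]
  congr 1
  refine integral_congr_ae ?_
  filter_upwards [h] with x hx
  rw [hx]

/-- The factor $l^\gamma$ comes from the homogeneity of the weight and $l^{-d}$ from the Jacobian.
-/
theorem wnorm_scaled {d : ℕ} {γ q : ℝ} (hq : 0 < q) {F : Type*} [NormedAddCommGroup F]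
    [NormedSpace ℝ F] (f : Space d → F) {a l : ℝ} (ha : 0 < a) (hl : 0 < l) :
    wnorm q γ (fun x => a • f (l • x)) ^ q = a ^ q * l ^ (γ - d) * wnorm q γ f ^ q := by
  rw [wnorm_rpow hq, wnorm_rpow hq]
  simp_rw [scaled_integrand f ha hl]
  rw [integral_const_mul, Measure.integral_comp_smul volume (fun x => ‖f x‖ ^ q * ‖x‖ ^ (-γ)),
    finrank_euclideanSpace, Fintype.card_fin, abs_of_pos (by positivity), smul_eq_mul,
    Real.rpow_sub hl, Real.rpow_natCast]
  ring

variable {d : ℕ} [hd : Fact (3 ≤ d)] {p γ : ℝ} [hp1 : Fact (1 < p)]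

/-- Test the identity for $w$ with $\varphi(l^{-1}\cdot)$ and change variables on both sides. -/
theorem HasWeakGradient.integral_eq_scaled {d : ℕ} {w : Space d → ℝ} {g : Space d → Space d}
    (h : HasWeakGradient w g) (a : ℝ) {l : ℝ} (hl : 0 < l) {φ : Space d → ℝ}
    (hφ : ContDiff ℝ ∞ φ) (hφc : HasCompactSupport φ) (v : Space d) :
    ∫ x, a • w (l • x) * fderiv ℝ φ x v = -∫ x, inner ℝ ((a * l) • g (l • x)) v * φ x := by
  have hψ : ContDiff ℝ ∞ fun x : Space d => φ (l⁻¹ • x) := hφ.comp (contDiff_const_smul _)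
  have hψc : HasCompactSupport fun x : Space d => φ (l⁻¹ • x) :=
    hφc.comp_homeomorph (Homeomorph.smulOfNeZero l⁻¹ (inv_ne_zero hl.ne'))
  have key := h.integral_eq _ hψ hψc v
  have hder : ∀ x, fderiv ℝ (fun x : Space d => φ (l⁻¹ • x)) x = l⁻¹ • fderiv ℝ φ (l⁻¹ • x) :=
    fun x => fderiv_comp_smul _
  simp_rw [hder] at key
  have e1 : ∫ x, a • w (l • x) * fderiv ℝ φ x v = a * l * |(l ^ d)⁻¹| *
      ∫ x, w x * (l⁻¹ • fderiv ℝ φ (l⁻¹ • x)) v := by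
    have h1 := Measure.integral_comp_smul (volume : Measure (Space d))
      (fun x => w x * (l⁻¹ • fderiv ℝ φ (l⁻¹ • x)) v) l
    rw [finrank_euclideanSpace, Fintype.card_fin, smul_eq_mul] at h1
    rw [mul_assoc, ← h1, ← integral_const_mul]
    refine integral_congr_ae (Eventually.of_forall fun x => ?_)
    simp only [smul_eq_mul, smul_apply, inv_smul_smul₀ hl.ne']
    field_simp
  have e2 : ∫ x, inner ℝ ((a * l) • g (l • x)) v * φ x = a * l * |(l ^ d)⁻¹| *
      ∫ x, inner ℝ (g x) v * φ (l⁻¹ • x) := by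
    have h1 := Measure.integral_comp_smul (volume : Measure (Space d))
      (fun x => inner ℝ (g x) v * φ (l⁻¹ • x)) l
    rw [finrank_euclideanSpace, Fintype.card_fin, smul_eq_mul] at h1
    rw [mul_assoc, ← h1, ← integral_const_mul]
    refine integral_congr_ae (Eventually.of_forall fun x => ?_)
    simp only [real_inner_smul_left, inv_smul_smul₀ hl.ne']
    ring
  rw [e1, e2, key]
  ring

/-- The scaling `w ↦ a w(l ·)` on `H_{p,γ}`. -/
theorem exists_scaled (hγ0 : 0 < γ) (w : HSpace d p γ) {a l : ℝ} (ha : 0 < a) (hl : 0 < l) :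
    ∃ v : HSpace d p γ,
      wnorm (p + 1) γ (fn v) ^ (p + 1)
        = a ^ (p + 1) * l ^ (γ - d) * wnorm (p + 1) γ (fn w) ^ (p + 1) ∧
      wnorm 2 0 (grad v) ^ 2 = a ^ 2 * l ^ (2 - d : ℝ) * wnorm 2 0 (grad w) ^ 2 ∧
      mass v = a ^ (2 * p) * l ^ (γ - d) * mass w := by
  have hp := hp1.out
  have hms : Measurable fun x : Space d => l • x := measurable_const_smul l
  have hwm : AEStronglyMeasurable (fun x => a • fn w (l • x)) volume :=
    (((measurable_fn w).comp hms).const_smul a).aestronglyMeasurable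
  have hgm : AEStronglyMeasurable (fun x => (a * l) • grad w (l • x)) volume :=
    (((measurable_grad w).comp hms).const_smul (a * l)).aestronglyMeasurable
  have h1 : MemLp (fun x => a • fn w (l • x)) (ENNReal.ofReal (p + 1)) (weightedMeasure d γ) := by
    rw [memLp_weightedMeasure_iff (by linarith) hwm]
    simp_rw [scaled_integrand (fn w) ha hl]
    refine Integrable.const_mul ?_ _
    exact ((memLp_weightedMeasure_iff (by linarith) (measurable_fn w).aestronglyMeasurable).1
      (Lp.memLp w.1.fst)).comp_smul hl.ne'
  have h2 : MemLp (fun x => (a * l) • grad w (l • x)) 2 volume := by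
    rw [memLp_two_iff_integrable_sq_norm hgm]
    simp_rw [norm_smul, mul_pow]
    refine Integrable.const_mul ?_ _
    exact ((memLp_two_iff_integrable_sq_norm (measurable_grad w).aestronglyMeasurable).1
      (Lp.memLp w.1.snd)).comp_smul hl.ne'
  obtain ⟨v, hv1, hv2⟩ := exists_HSpace (p := p) hγ0.le hwm h1 h2
    fun φ hφ hφc v => (hasWeakGradient w).integral_eq_scaled a hl hφ hφc v
  refine ⟨v, ?_, ?_, ?_⟩
  · rw [wnorm_congr hv1, wnorm_scaled (by linarith) _ ha hl]
  · have e : (a * l) ^ (2 : ℝ) * l ^ ((0 : ℝ) - d) = a ^ 2 * l ^ (2 - d : ℝ) := by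
      rw [Real.mul_rpow ha.le hl.le, Real.rpow_two, Real.rpow_sub hl, Real.rpow_sub hl,
        Real.rpow_zero, Real.rpow_two]
      ring
    rw [wnorm_congr hv2, ← Real.rpow_two (wnorm 2 0 (grad w)), ← e,
      ← wnorm_scaled (by norm_num) (grad w) (mul_pos ha hl) hl, Real.rpow_two]
  · rw [mass, mass, wnorm_congr hv1, wnorm_scaled (by linarith) _ ha hl]

/-- The denominator equals $(d-\gamma-p(d-2))+p(2-\gamma)$, a sum of positive terms. -/
theorem theta_den_pos {d : ℕ} {p γ : ℝ} [hp1 : Fact (1 < p)] (hγ2 : γ < 2) (hp : p * (d - 2) < d - γ) :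
    0 < d - γ - p * (d + γ - 4) := by
  have hp1 := hp1.out
  nlinarith

/-- Both terms of $\mathcal G_\gamma$ get the same factor when $a^{p-1}=l^{2-\gamma}$. Combined with
$a^{2p}l^{\gamma-d}=m$ this forces the powers of $m$ used for $a$ and $l$, and the common factor is
$m^{\theta_\gamma}$. -/
theorem exists_scaled_mass (hγ0 : 0 < γ) (hγ2 : γ < 2) (hp : p * (d - 2) < d - γ)
    (w : HSpace d p γ) {m : ℝ} (hm : 0 < m) :
    ∃ v : HSpace d p γ, mass v = m * mass w ∧ G v = m ^ theta d p γ * G w := by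
  have hp1 := hp1.out
  have hden := theta_den_pos (p := p) hγ2 hp
  have h2γ : 0 < 2 - γ := by linarith
  obtain ⟨N, hN⟩ : ∃ N : ℝ, N = d - γ - p * (d + γ - 4) := ⟨_, rfl⟩
  have hN0 : 0 < N := hN ▸ hden
  obtain ⟨v, h1, h2, h3⟩ := exists_scaled hγ0 w (a := m ^ ((2 - γ) / N))
    (l := m ^ ((p - 1) / N)) (by positivity) (by positivity)
  rw [← Real.rpow_mul hm.le, ← Real.rpow_mul hm.le, ← Real.rpow_add hm] at h1 h3
  have hsq : (m ^ ((2 - γ) / N)) ^ 2 = m ^ ((2 - γ) / N * 2) := by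
    rw [Real.rpow_mul hm.le, Real.rpow_two]
  rw [hsq, ← Real.rpow_mul hm.le, ← Real.rpow_add hm] at h2
  have e1 : (2 - γ) / N * (p + 1) + (p - 1) / N * (γ - d) = theta d p γ := by
    rw [theta, ← hN]
    field_simp
    ring
  have e2 : (2 - γ) / N * 2 + (p - 1) / N * (2 - d) = theta d p γ := by
    rw [theta, ← hN]
    field_simp
    ring
  have e3 : (2 - γ) / N * (2 * p) + (p - 1) / N * (γ - d) = 1 := by
    field_simp
    rw [hN]
    ring
  rw [e1] at h1
  rw [e2] at h2
  rw [e3, Real.rpow_one] at h3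
  refine ⟨v, h3, ?_⟩
  rw [G, G, h1, h2]
  ring

end Scaling

end CKN

/-! ### Existence of minimizers and the optimal constant -/

namespace CKN

open Filter Set
open scoped Topology NNReal

section Existence

variable {d : ℕ} [hd : Fact (3 ≤ d)] {p γ : ℝ} [hp1 : Fact (1 < p)]

theorem mass_pos (hγ0 : 0 < γ) (hp : p * (d - 2) < d - γ) {w : HSpace d p γ} (hw : w ≠ 0) :
    0 < mass w := by
  rw [mass_eq hγ0 hp]
  refine Real.rpow_pos_of_pos (norm_pos_iff.2 fun h => hw ?_) _
  exact embedding_injective hγ0 hp (h.trans (map_zero _).symm)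

theorem gamma_lt (hγ2 : γ < 2) : γ < d := by
  have hd' : (3 : ℝ) ≤ d := by exact_mod_cast hd.out
  linarith

/-- A smooth bump works, since the weight is integrable at the origin; scaling it will show that
every mass is attained. -/
theorem exists_ne_zero (hγ0 : 0 < γ) (hγ2 : γ < 2) : ∃ w : HSpace d p γ, w ≠ 0 := by
  let φ : ContDiffBump (0 : Space d) := ⟨1, 2, one_pos, one_lt_two⟩
  have hφ : ContDiff ℝ ∞ φ := φ.contDiff
  have hφc : HasCompactSupport φ := φ.hasCompactSupport
  have hcont : Continuous fun x => (InnerProductSpace.toDual ℝ (Space d)).symm (fderiv ℝ φ x) :=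
    (InnerProductSpace.toDual ℝ (Space d)).symm.continuous.comp (hφ.continuous_fderiv (by simp))
  have h1 : MemLp φ (ENNReal.ofReal (p + 1)) (weightedMeasure d γ) := by
    refine (memLp_indicator_const (ENNReal.ofReal (p + 1)) (measurableSet_ball (x := (0 : Space d))
      (ε := φ.rOut)) (1 : ℝ)
      (Or.inr (weightedMeasure_ball_lt_top hd.out (gamma_lt hγ2) _).ne)).mono
      φ.continuous.aestronglyMeasurable (Eventually.of_forall fun x => ?_)
    by_cases hx : x ∈ Metric.ball (0 : Space d) φ.rOut
    · rw [indicator_of_mem hx, norm_one, Real.norm_of_nonneg φ.nonneg]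
      exact φ.le_one
    · have : φ x = 0 := by
        rw [← Function.notMem_support, φ.support_eq]
        exact hx
      simp [this]
  have h2 : MemLp (fun x => (InnerProductSpace.toDual ℝ (Space d)).symm (fderiv ℝ φ x)) 2
      volume := by
    refine hcont.memLp_of_hasCompactSupport ?_
    exact (hφc.fderiv (𝕜 := ℝ)).comp_left (map_zero _)
  obtain ⟨w, hw, -⟩ := exists_HSpace (p := p) hγ0.le φ.continuous.aestronglyMeasurable h1 h2
    (fun ψ hψ hψc v => by
      simp only [InnerProductSpace.toDual_symm_apply]
      have c1 : Continuous fun x => fderiv ℝ φ x v :=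
        (hφ.continuous_fderiv (by simp)).clm_apply continuous_const
      have c2 : Continuous fun x => fderiv ℝ ψ x v :=
        (hψ.continuous_fderiv (by simp)).clm_apply continuous_const
      exact integral_mul_fderiv_eq_neg_fderiv_mul_of_integrable
        ((c1.mul hψ.continuous).integrable_of_hasCompactSupport hψc.mul_left)
        ((φ.continuous.mul c2).integrable_of_hasCompactSupport hφc.mul_right)
        ((φ.continuous.mul hψ.continuous).integrable_of_hasCompactSupport hφc.mul_right)
        (fun x _ => hφ.differentiable (by simp) x) fun x _ => hψ.differentiable (by simp) x)
  refine ⟨w, fun h0 => ?_⟩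
  have h3 : fn w =ᵐ[volume] 0 := by
    rw [h0]
    exact ae_volume_of_ae_weightedMeasure (γ := γ) (Lp.coeFn_zero _ _ _)
  have h4 : (φ : Space d → ℝ) = 0 :=
    (Continuous.ae_eq_iff_eq volume φ.continuous continuous_zero).1 (hw.symm.trans h3)
  have h5 : φ 0 = 1 := φ.one_of_mem_closedBall (by simp [φ.rIn_pos.le])
  rw [h4] at h5
  simp at h5

theorem exists_mass_eq (hγ0 : 0 < γ) (hγ2 : γ < 2) (hp : p * (d - 2) < d - γ) {M : ℝ}
    (hM : 0 < M) : ∃ w : HSpace d p γ, mass w = M := by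
  obtain ⟨w, hw⟩ := exists_ne_zero (d := d) (p := p) hγ0 hγ2
  have h0 := mass_pos hγ0 hp hw
  obtain ⟨v, hv, -⟩ := exists_scaled_mass hγ0 hγ2 hp w (div_pos hM h0)
  exact ⟨v, by rw [hv, div_mul_cancel₀ _ h0.ne']⟩

theorem G_nonneg (w : HSpace d p γ) : 0 ≤ G w := by
  have hp := hp1.out
  rw [G_eq]
  positivity

/-- Lower semicontinuity: limits in `L^{2p}_γ` of sequences with converging norms. -/
theorem exists_limit (hγ0 : 0 < γ) (hp : p * (d - 2) < d - γ) {w : ℕ → HSpace d p γ}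
    {f : WLp d γ (2 * p)} (hf : Tendsto (fun n => embedding hγ0 hp (w n)) atTop (𝓝 f))
    {a b K : ℝ} (ha : Tendsto (fun n => ‖(w n).1.fst‖) atTop (𝓝 a))
    (hb : Tendsto (fun n => ‖(w n).1.snd‖) atTop (𝓝 b)) (hK : ∀ n, ‖(w n).1.snd‖ ≤ K) :
    ∃ v : HSpace d p γ, embedding hγ0 hp v = f ∧ ‖v.1.fst‖ ≤ a ∧ ‖v.1.snd‖ ≤ b := by
  have hp1 := hp1.out
  have hfm : Measurable (f : Space d → ℝ) := (Lp.stronglyMeasurable f).measurable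
  have ha0 : 0 ≤ a := ge_of_tendsto ha (Eventually.of_forall fun n => norm_nonneg _)
  -- A subsequence converges a.e., so Fatou's lemma bounds the $L^{p+1}_\gamma$ norm of the limit.
  obtain ⟨ns, hns, hae⟩ := (tendstoInMeasure_of_tendsto_Lp hf).exists_seq_tendsto_ae
  have hfatou : eLpNorm f (ENNReal.ofReal (p + 1)) (weightedMeasure d γ) ≤ ENNReal.ofReal a := by
    have hae' : ∀ᵐ x ∂(weightedMeasure d γ),
        Tendsto (fun n => fn (w (ns n)) x) atTop (𝓝 (f x)) := by
      have h1 : ∀ᵐ x ∂(weightedMeasure d γ), ∀ n,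
          embedding hγ0 hp (w (ns n)) x = fn (w (ns n)) x :=
        ae_all_iff.2 fun n => coeFn_embedding hγ0 hp _
      filter_upwards [hae, h1] with x hx hx1
      simpa only [hx1] using hx
    refine (Lp.eLpNorm_lim_le_liminf_eLpNorm
      (fun n => (measurable_fn (w (ns n))).aestronglyMeasurable) _ hae').trans ?_
    have h2 : Tendsto (fun n => eLpNorm (fn (w (ns n))) (ENNReal.ofReal (p + 1))
        (weightedMeasure d γ)) atTop (𝓝 (ENNReal.ofReal a)) := by
      refine (ENNReal.tendsto_ofReal (ha.comp hns.tendsto_atTop)).congr fun n => ?_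
      simp only [Function.comp_apply]
      rw [ofReal_norm, Lp.enorm_def, fn]
    exact h2.liminf_eq.le
  have hfL : MemLp f (ENNReal.ofReal (p + 1)) (weightedMeasure d γ) :=
    ⟨hfm.aestronglyMeasurable, hfatou.trans_lt ENNReal.ofReal_lt_top⟩
  have hU : (hyperfilter ℕ : Filter ℕ) ≤ atTop := Nat.hyperfilter_le_atTop
  obtain ⟨g, hgb, hg⟩ := exists_weak_limit (hyperfilter ℕ) (fun n => (w n).1.snd) hK
    (hb.mono_left hU)
  have hint : ∀ φ : Space d → ℝ, ContDiff ℝ ∞ φ → HasCompactSupport φ → ∀ v : Space d,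
      ∫ x, f x * fderiv ℝ φ x v = -∫ x, inner ℝ (g x) v * φ x := by
    intro φ hφ hφc v
    have h1 := (tendsto_integral_mul hd.out hγ0 (by linarith) hf
      (ψ := fun x => fderiv ℝ φ x v)
      ((hφ.continuous_fderiv (by simp)).clm_apply continuous_const)
      (hφc.fderiv_apply (𝕜 := ℝ) v)).mono_left hU
    -- Pairing with $\varphi v\in L^2$ expresses the right side of the weak gradient identity as an
    -- inner product, so it passes to the weak limit.
    have hψ : MemLp (fun x => φ x • v) 2 (volume : Measure (Space d)) :=
      (hφ.continuous.smul continuous_const).memLp_of_hasCompactSupport hφc.smul_right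
    have hinner : ∀ k : Lp (Space d) 2 (volume : Measure (Space d)),
        inner ℝ k (hψ.toLp _) = ∫ x, inner ℝ (k x) v * φ x := by
      intro k
      rw [L2.inner_def]
      refine integral_congr_ae ?_
      filter_upwards [hψ.coeFn_toLp] with x hx
      rw [hx, real_inner_smul_right, mul_comm]
    have h2 := hg (hψ.toLp _)
    simp only [hinner] at h2
    have h3 : ∀ n, ∫ x, embedding hγ0 hp (w n) x * fderiv ℝ φ x v
        = -∫ x, inner ℝ ((w n).1.snd x) v * φ x := by
      intro n
      have h4 := (hasWeakGradient (w n)).integral_eq φ hφ hφc v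
      refine Eq.trans (integral_congr_ae ?_) h4
      filter_upwards [ae_volume_of_ae_weightedMeasure (coeFn_embedding hγ0 hp (w n))] with x hx
      rw [hx]
    simp only [h3] at h1
    exact tendsto_nhds_unique h1 h2.neg
  obtain ⟨v, hv1, hv2⟩ := exists_HSpace (p := p) hγ0.le hfm.aestronglyMeasurable hfL
    (Lp.memLp g) hint
  have hv1' := (weightedMeasure_absolutelyContinuous d γ).ae_le hv1
  refine ⟨v, Lp.ext ((coeFn_embedding hγ0 hp v).trans hv1'), ?_, ?_⟩
  · rw [Lp.norm_def]
    refine ENNReal.toReal_le_of_le_ofReal ha0 ?_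
    exact (eLpNorm_congr_ae hv1').trans_le hfatou
  · have h1 : v.1.snd = g := Lp.ext hv2
    rw [h1]
    exact hgb

/-- The direct method: the constraint is continuous for the compact embedding, while the energy can
only drop in the limit. -/
theorem exists_minimizer (hγ0 : 0 < γ) (hγ2 : γ < 2) (hp : p * (d - 2) < d - γ) {M : ℝ}
    (hM : 0 < M) : ∃ w : HSpace d p γ, mass w = M ∧ IsMinOn G {v : HSpace d p γ | mass v = M} w := by
  have hp1 := hp1.out
  have hbdd : BddBelow (G '' {v : HSpace d p γ | mass v = M}) :=
    ⟨0, by rintro _ ⟨v, -, rfl⟩; exact G_nonneg v⟩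
  have hne : (G '' {v : HSpace d p γ | mass v = M}).Nonempty :=
    (exists_mass_eq hγ0 hγ2 hp hM).elim fun w hw => ⟨G w, w, hw, rfl⟩
  obtain ⟨y, -, hy, hyS⟩ := exists_seq_tendsto_sInf hne hbdd
  choose w hwM hwG using hyS
  obtain ⟨C, hC⟩ := hy.bddAbove_range
  obtain ⟨K, hK⟩ := exists_bound_of_G_le (d := d) (γ := γ) p C
  have hwK : ∀ n, ‖(w n).1.fst‖ ≤ K ∧ ‖(w n).1.snd‖ ≤ K := fun n =>
    hK _ (by rw [hwG]; exact hC (mem_range_self n))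
  obtain ⟨S, hS, hsub⟩ := (isCompactOperator_embedding (p := p) hγ0 hp
    ).image_closedBall_subset_compact (f := (embedding hγ0 hp).toLinearMap) (K + K)
  -- Including both norms in the compact product makes a single subsequence converge for all three
  -- quantities; then `a` and `b` compute the limit of the energies.
  have hmem : ∀ n, (embedding hγ0 hp (w n), ‖(w n).1.fst‖, ‖(w n).1.snd‖)
      ∈ S ×ˢ (Icc 0 K ×ˢ Icc 0 K) := by
    intro n
    refine ⟨hsub ⟨w n, ?_, rfl⟩, ⟨norm_nonneg _, (hwK n).1⟩, ⟨norm_nonneg _, (hwK n).2⟩⟩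
    rw [mem_closedBall_zero_iff, norm_eq_add]
    exact add_le_add (hwK n).1 (hwK n).2
  obtain ⟨⟨f, a, b⟩, -, φ, hφ, hlim⟩ :=
    (hS.prod (isCompact_Icc.prod isCompact_Icc)).tendsto_subseq hmem
  rw [Prod.tendsto_iff, Prod.tendsto_iff] at hlim
  obtain ⟨hf, ha, hb⟩ := hlim
  obtain ⟨v, hvf, hva, hvb⟩ := exists_limit hγ0 hp (w := fun n => w (φ n)) hf ha hb
    fun n => (hwK _).2
  have ha0 : 0 ≤ a := (norm_nonneg _).trans hva
  have hvM : mass v = M := by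
    have h1 : Tendsto (fun n => mass (w (φ n))) atTop (𝓝 (mass v)) := by
      simp only [mass_eq hγ0 hp, hvf]
      exact hf.norm.rpow_const (Or.inr (by linarith))
    have h2 : (fun n => mass (w (φ n))) = fun _ => M := funext fun n => hwM _
    rw [h2] at h1
    exact tendsto_nhds_unique h1 tendsto_const_nhds
  have hGlim : Tendsto (fun n => G (w (φ n))) atTop
      (𝓝 (1 / 2 * b ^ 2 + 1 / (p + 1) * a ^ (p + 1))) := by
    simp only [G_eq]
    exact ((hb.pow 2).const_mul _).add
      ((ha.rpow_const (Or.inr (by linarith))).const_mul _)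
  have hI : 1 / 2 * b ^ 2 + 1 / (p + 1) * a ^ (p + 1)
      = sInf (G '' {v : HSpace d p γ | mass v = M}) := by
    refine tendsto_nhds_unique hGlim ?_
    simp only [hwG]
    exact hy.comp hφ.tendsto_atTop
  refine ⟨v, hvM, isMinOn_iff.2 fun u hu => ?_⟩
  have h1 : sInf (G '' {v : HSpace d p γ | mass v = M}) ≤ G u := csInf_le hbdd ⟨u, hu, rfl⟩
  refine le_trans ?_ h1
  rw [← hI, G_eq]
  gcongr

theorem J_eq (hγ0 : 0 < γ) (hγ2 : γ < 2) (hp : p * (d - 2) < d - γ) {M : ℝ} (hM : 0 < M)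
    {w : HSpace d p γ} (hwM : mass w = M)
    (hw : IsMinOn G {v : HSpace d p γ | mass v = M} w) :
    G w = J d p γ * M ^ theta d p γ := by
  have hp1 := hp1.out
  have hMθ : 0 < M ^ theta d p γ := Real.rpow_pos_of_pos hM _
  -- The numerator is $(d-\gamma-p(d-2))+(2-\gamma)>0$. Positivity of $\theta_\gamma$ gives
  -- $0^{\theta_\gamma}=0$ for the case $v=0$ below.
  have hθ : 0 < theta d p γ := by
    refine div_pos ?_ (theta_den_pos hγ2 hp)
    linarith
  have hpow : ∀ v : HSpace d p γ,
      wnorm (2 * p) γ (fn v) ^ (2 * p * theta d p γ) = mass v ^ theta d p γ := by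
    intro v
    rw [mass, Real.rpow_mul]
    exact Real.rpow_nonneg (integral_nonneg fun x => by positivity) _
  -- Rescaling any nonzero `v` to mass `M` and comparing with the minimizer proves the inequality
  -- with this constant; evaluating at `w` shows that no larger constant is possible.
  have hgreat : IsGreatest {C : ℝ | ∀ w : HSpace d p γ,
      0 ≤ G w - C * wnorm (2 * p) γ (fn w) ^ (2 * p * theta d p γ)} (G w / M ^ theta d p γ) := by
    refine ⟨fun v => ?_, fun C hC => ?_⟩
    · rw [hpow, sub_nonneg]
      rcases eq_or_ne v 0 with rfl | hv
      · have h0 : mass (0 : HSpace d p γ) = 0 := by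
          rw [mass_eq hγ0 hp, map_zero, norm_zero, Real.zero_rpow (by linarith)]
        rw [h0, Real.zero_rpow hθ.ne', mul_zero]
        exact G_nonneg _
      · have hv0 := mass_pos hγ0 hp hv
        obtain ⟨u, hu1, hu2⟩ := exists_scaled_mass hγ0 hγ2 hp v (div_pos hM hv0)
        rw [div_mul_cancel₀ _ hv0.ne'] at hu1
        have h1 : G w ≤ G u := isMinOn_iff.1 hw u hu1
        rw [hu2, Real.div_rpow hM.le hv0.le] at h1
        have hvθ : 0 < mass v ^ theta d p γ := Real.rpow_pos_of_pos hv0 _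
        rw [div_mul_eq_mul_div, div_le_iff₀ hMθ]
        calc G w * mass v ^ theta d p γ
            ≤ (M ^ theta d p γ / mass v ^ theta d p γ * G v) * mass v ^ theta d p γ := by gcongr
          _ = G v * M ^ theta d p γ := by field_simp
    · have h1 := hC w
      rw [hpow, hwM, sub_nonneg] at h1
      rwa [le_div_iff₀ hMθ]
  rw [J, hgreat.csSup_eq, div_mul_cancel₀ _ hMθ.ne']

end Existence

end CKN

theorem mainTheorem6 (d : ℕ) [Fact (3 ≤ d)] (p γ : ℝ) [Fact (1 < p)]
    (hγ0 : 0 < γ) (hγ2 : γ < 2) (hp : p < CKN.critExp d γ / 2) :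
    (∃ ι : CKN.HSpace d p γ →L[ℝ] CKN.WLp d γ (2 * p),
      (∀ w : CKN.HSpace d p γ, (ι w : CKN.Space d → ℝ) =ᵐ[volume] CKN.fn w) ∧
      Function.Injective ι ∧ IsCompactOperator ι) ∧
    (∀ M : ℝ, 0 < M →
      CKN.J d p γ = 1 / M ^ CKN.theta d p γ *
        sInf (CKN.G '' {w : CKN.HSpace d p γ | CKN.mass w = M}) ∧
      ∃ w : CKN.HSpace d p γ, CKN.mass w = M ∧
        IsMinOn CKN.G {v : CKN.HSpace d p γ | CKN.mass v = M} w ∧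
        CKN.G w = CKN.J d p γ * M ^ CKN.theta d p γ) := by
  have hd : (3 : ℝ) ≤ d := by exact_mod_cast (Fact.out : 3 ≤ d)
  have hp' : p * (d - 2) < d - γ := by
    rwa [CKN.critExp, mul_div_cancel_left₀ _ two_ne_zero, lt_div_iff₀ (by linarith)] at hp
  refine ⟨⟨CKN.embedding hγ0 hp', fun w => CKN.ae_volume_of_ae_weightedMeasure
    (CKN.coeFn_embedding hγ0 hp' w), CKN.embedding_injective hγ0 hp',
    CKN.isCompactOperator_embedding hγ0 hp'⟩, fun M hM => ?_⟩
  obtain ⟨w, hwM, hw⟩ := CKN.exists_minimizer (d := d) (p := p) hγ0 hγ2 hp' hM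
  have hJ := CKN.J_eq hγ0 hγ2 hp' hM hwM hw
  have hMθ : 0 < M ^ CKN.theta d p γ := Real.rpow_pos_of_pos hM _
  have hinf : IsLeast (CKN.G '' {w : CKN.HSpace d p γ | CKN.mass w = M}) (CKN.G w) :=
    ⟨⟨w, hwM, rfl⟩, by rintro _ ⟨u, hu, rfl⟩; exact isMinOn_iff.1 hw u hu⟩
  refine ⟨?_, w, hwM, hw, hJ⟩
  rw [hinf.csInf_eq, hJ]
  field_simp
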